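/- There are universal constants $\kappa_0,c,C>0$ such that the following holds. Let $A\in\mathbb R^{d_x\times d_x}$ be stable (spectral radius $\rho(A)<1$), let $r\ge \mathrm{rank}(A)$, $\delta\in(0,1)$ and $\kappa\ge\kappa_0$. Let $x_0=0$ and $x_{t+1}=Ax_t+\eta_t$ for $t\ge 0$, where $(\eta_t)_{t\ge0}$ are i.i.d. random vectors with $\mathbb E[\eta_t]=0$ that are $\sigma^2$-subgaussian, i.e. $\mathbb E\,e^{\langle\theta,\eta_t\rangle}\le e^{\sigma^2\|\theta\|^2/2}$ for all $\theta\in\mathbb R^{d_x}$, and satisfy $\mathbb E[\eta_t\eta_t^\top]\succeq I$ (in particular, isotropic noise, $\mathbb E[\eta_t\eta_t^\top]=I$, is allowed). Put $\Gamma_\infty(A)=\sum_{t\ge0}A^t(A^t)^\top$ and let $s_1(A)\ge s_2(A)\ge\dots$ be the singular values of $A$. From $x_1,\dots,x_{n+1}$ form $X\in\mathbb R^{n\times d_x}$ with rows $x_1^\top,\dots,x_n^\top$, $Y\in\mathbb R^{n\times d_x}$ with rows $x_2^\top,\dots,x_{n+1}^\top$, the empirical covariance $\hat\Sigma=\frac1nX^\top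 X$, and the least squares estimator $\bar A=Y^\top X(X^\top X)^{-1}$. The thresholded estimator T-LSE is $$\hat A_n=\sum_{i:\,s_i(\bar A)\ge\xi}s_i(\bar A)\,u_iv_i^\top,\qquad \xi=\kappa\,\sigma\sqrt{\frac{d_x+\log(1/\delta)}{n\,\lambda_{\min}(\hat\Sigma)}},$$ where $\bar A=\sum_i s_i(\bar A)u_iv_i^\top$ is a singular value decomposition. If $$n\ \ge\ \frac{c\,\sigma^4\,\|\Gamma_\infty(A)\|_2^3}{\lambda_{\min}(\Gamma_\infty(A))}\Big(d_x+\log\frac1\delta\Big),$$ then, with probability at least $1-\delta$, $X^\top X$ is invertible and $$\|\hat A_n-A\|_{\mathrm F}^2\ \le\ C\kappa^2\min_{0\le k\le r}\left[\frac{k\,\sigma^2\,(d_x+\log(1/\delta))}{n\,\lambda_{\min}(\Gamma_\infty(A))}+\sum_{i>k}s_i^2(A)\right].$$ -/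

import Mathlib

open MeasureTheory ProbabilityTheory
open scoped Matrix NNReal ENNReal

noncomputable section

namespace LTI

/-- The trajectory of the linear system `x 0 = 0`, `x (t + 1) = A x t + e t` driven by `e`. -/
def trajectory {d : ℕ} (A : Matrix (Fin d) (Fin d) ℝ) (e : ℕ → Fin d → ℝ) : ℕ → Fin d → ℝ
  | 0 => 0
  | t + 1 => A *ᵥ trajectory A e t + e t

/-- The covariate matrix, with rows `x 1, …, x n`. -/
def covariates {d : ℕ} (n : ℕ) (x : ℕ → Fin d → ℝ) : Matrix (Fin n) (Fin d) ℝ :=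
  Matrix.of fun i j => x ((i : ℕ) + 1) j

/-- The response matrix, with rows `x 2, …, x (n + 1)`. -/
def responses {d : ℕ} (n : ℕ) (x : ℕ → Fin d → ℝ) : Matrix (Fin n) (Fin d) ℝ :=
  Matrix.of fun i j => x ((i : ℕ) + 2) j

/-- The empirical covariance matrix `n⁻¹ Xᵀ X`. -/
def empCov {n d : ℕ} (X : Matrix (Fin n) (Fin d) ℝ) : Matrix (Fin d) (Fin d) ℝ :=
  (n : ℝ)⁻¹ • (Xᵀ * X)

/-- The least squares estimator `Yᵀ X (Xᵀ X)⁻¹`, meaningful when `Xᵀ X` is invertible. -/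
def leastSquares {n d d' : ℕ} (X : Matrix (Fin n) (Fin d) ℝ) (Y : Matrix (Fin n) (Fin d') ℝ) :
    Matrix (Fin d') (Fin d) ℝ :=
  Yᵀ * X * (Xᵀ * X)⁻¹

/-- The singular values of `M`, in decreasing order, indexed from `0` and followed by zeros. -/
def singularValue {m d : ℕ} (M : Matrix (Fin m) (Fin d) ℝ) (i : ℕ) : ℝ :=
  (Matrix.toLpLin 2 2 M).singularValues i

/-- Hard thresholding of the singular values of `M` at level `ξ`: the sum of `s_i u_i v_iᵀ` over
those `i` for which `ξ ≤ s_i`. Here `v_i` runs through an orthonormal eigenbasis of `Mᵀ M`, the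
singular value `s_i` is the square root of the eigenvalue that belongs to `v_i`, and
`s_i u_i = M v_i`. The result does not depend on the choice of the eigenbasis. -/
def svThreshold {m d : ℕ} (ξ : ℝ) (M : Matrix (Fin m) (Fin d) ℝ) : Matrix (Fin m) (Fin d) ℝ :=
  let h := Matrix.isHermitian_conjTranspose_mul_self M
  ∑ i : Fin d,
    if ξ ≤ √(h.eigenvalues i) then
      Matrix.vecMulVec (M *ᵥ (h.eigenvectorBasis i).ofLp) (h.eigenvectorBasis i).ofLp
    else 0

/-- The smallest eigenvalue of a real symmetric matrix. -/
def lamMin {d : ℕ} (M : Matrix (Fin d) (Fin d) ℝ) : ℝ := sInf (spectrum ℝ M)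

/-- The spectral norm: the operator norm for the Euclidean norm. -/
def opNorm {d : ℕ} (M : Matrix (Fin d) (Fin d) ℝ) : ℝ := ‖Matrix.toEuclideanCLM (𝕜 := ℝ) M‖

/-- The squared Frobenius norm. -/
def frobSq {m d : ℕ} (M : Matrix (Fin m) (Fin d) ℝ) : ℝ := ∑ i, ∑ j, M i j ^ 2

/-- Stability: the spectral radius, over the complex numbers, is less than `1`. -/
def Stable {d : ℕ} (A : Matrix (Fin d) (Fin d) ℝ) : Prop :=
  spectralRadius ℂ (A.map (algebraMap ℝ ℂ)) < 1

/-- The infinite-horizon controllability Gramian `∑ₜ Aᵗ (Aᵗ)ᵀ` (the series converges for stable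
matrices). -/
def gramian {d : ℕ} (A : Matrix (Fin d) (Fin d) ℝ) : Matrix (Fin d) (Fin d) ℝ :=
  ∑' t : ℕ, A ^ t * (A ^ t)ᵀ

/-- The threshold `κ σ √((d + log (1/δ)) / (n lamMin Σ))`, where `Σ` is the empirical covariance. -/
def threshold {n d : ℕ} (κ σ δ : ℝ) (X : Matrix (Fin n) (Fin d) ℝ) : ℝ :=
  κ * σ * √(((d : ℝ) + Real.log (1 / δ)) / (n * lamMin (empCov X)))

/-- The thresholded least squares estimator computed from the samples `x 1, …, x (n + 1)`. -/
def tlse {d : ℕ} (κ σ δ : ℝ) (n : ℕ) (x : ℕ → Fin d → ℝ) : Matrix (Fin d) (Fin d) ℝ :=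
  svThreshold (threshold κ σ δ (covariates n x)) (leastSquares (covariates n x) (responses n x))

/-- The trade-off between estimation and approximation:
`k σ² (d + log (1/δ)) / (n lamMin Γ_∞)` plus the sum of the squares of all singular values of `A`
beyond the `k` largest. -/
def tradeOff {d : ℕ} (A : Matrix (Fin d) (Fin d) ℝ) (σ δ : ℝ) (n k : ℕ) : ℝ :=
  k * σ ^ 2 * ((d : ℝ) + Real.log (1 / δ)) / (n * lamMin (gramian A))
    + ∑ i ∈ Finset.Ico k d, singularValue A i ^ 2

end LTI

end

/-! The proof separates a deterministic inequality for singular value thresholding from a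
high-probability bound in operator norm.

Deterministic half (`hsSq_threshold_sub_le`). Suppose `‖M - A‖ ≤ ξ/2`. Where `M` stretches by at
least `ξ`, `A` stretches by at least `ξ/2`; a dimension count therefore allows at most `k` retained
directions, plus a number paid for by the tail of `A` beyond its `k` largest singular values. Each
retained direction costs at most `ξ²/4`. On the discarded ones `A` has norm at most `3ξ/2`, so its
part of rank `k` costs `O(k ξ²)` and the remainder is tail. This holds for every `k` at once, hence
for the minimum.

Probabilistic half. Let `Q` be the noise covariance, `Γ_Q = ∑ Aᵗ Q (Aᵗ)ᵀ` and `D = d + log (1/δ)`.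
The quadratic form of `XᵀX` solves a discrete Lyapunov equation (`energy_eq`) whose forcing is the
noise covariance, a drift-noise cross term and a boundary term. If the forcing is close to `n Q`,
comparison of Lyapunov solutions gives `(n/2) Γ_Q ≤ XᵀX ≤ (3/2) n Γ_Q` (`energy_bounds`). The cross
term is a martingale whose quadratic variation is again controlled by `XᵀX`, so its bound is closed
by a bootstrap (`opNorm_crossMat_le`).

The least squares error is `(XᵀX)⁻¹` applied to the score `∑ x_t e_tᵀ`. Since `XᵀX` is comparable to
the deterministic `Γ_Q`, the score can be whitened by a fixed matrix and tested on a fixed net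
(`score_le_of_testFunctions`); this gives an error of order `σ √(D / (n λ_min(Σ̂)))`, which is at
most `ξ/2` once `κ ≥ 50`.

All the randomness enters through finitely many exponential supermartingales indexed by pairs of net
points (`testFunctions`). Each starts at 1 and is bounded by Markov's inequality; a union bound over
`5 · 25 ^ d` of them is absorbed by the level `τ = 6 D` (`exists_goodEvent`). Everything else is
deterministic on that event. -/

namespace LTI

set_option linter.unusedSectionVars false

/-! ### Hilbert–Schmidt norms and the deterministic thresholding inequality. -/

section HilbertSchmidt

variable {E F : Type*} [NormedAddCommGroup E] [InnerProductSpace ℝ E] [FiniteDimensional ℝ E]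
  [NormedAddCommGroup F] [InnerProductSpace ℝ F] [FiniteDimensional ℝ F]

/-- The squared Hilbert–Schmidt norm. -/
noncomputable def hsSq (T : E →ₗ[ℝ] F) : ℝ := ∑ i, ‖T (stdOrthonormalBasis ℝ E i)‖ ^ 2

/-- Parseval in both bases turns either side into the double sum of squared matrix entries. Varying
`b` with `c` fixed then yields independence of the basis. -/
lemma sum_norm_sq_eq_sum_adjoint {ι κ : Type*} [Fintype ι] [Fintype κ]
    (b : OrthonormalBasis ι ℝ E) (c : OrthonormalBasis κ ℝ F) (T : E →ₗ[ℝ] F) :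
    ∑ i, ‖T (b i)‖ ^ 2 = ∑ j, ‖T.adjoint (c j)‖ ^ 2 := by
  simp_rw [← c.sum_sq_norm_inner_right (T _), ← b.sum_sq_norm_inner_right (T.adjoint _)]
  rw [Finset.sum_comm]
  refine Finset.sum_congr rfl fun j _ => Finset.sum_congr rfl fun i _ => ?_
  rw [LinearMap.adjoint_inner_right, real_inner_comm]

lemma sum_norm_sq_eq_hsSq {ι : Type*} [Fintype ι] (b : OrthonormalBasis ι ℝ E) (T : E →ₗ[ℝ] F) :
    ∑ i, ‖T (b i)‖ ^ 2 = hsSq T := by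
  rw [hsSq, sum_norm_sq_eq_sum_adjoint b (stdOrthonormalBasis ℝ F),
    sum_norm_sq_eq_sum_adjoint (stdOrthonormalBasis ℝ E) (stdOrthonormalBasis ℝ F)]

lemma hsSq_adjoint (T : E →ₗ[ℝ] F) : hsSq T.adjoint = hsSq T :=
  (sum_norm_sq_eq_sum_adjoint (stdOrthonormalBasis ℝ E) (stdOrthonormalBasis ℝ F) T).symm

/-- Bessel's inequality for each `T.adjoint (c j)`, after exchanging the sums. -/
lemma sum_orthonormal_norm_sq_le_hsSq {ι : Type*} [Fintype ι] {v : ι → E} (hv : Orthonormal ℝ v)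
    (T : E →ₗ[ℝ] F) : ∑ i, ‖T (v i)‖ ^ 2 ≤ hsSq T := by
  rw [← hsSq_adjoint, hsSq]
  simp_rw [← (stdOrthonormalBasis ℝ F).sum_sq_norm_inner_right (T _)]
  rw [Finset.sum_comm]
  refine Finset.sum_le_sum fun j _ => ?_
  refine le_trans (le_of_eq ?_)
    (hv.sum_inner_products_le (T.adjoint (stdOrthonormalBasis ℝ F j)) (s := Finset.univ))
  refine Finset.sum_congr rfl fun i _ => ?_
  rw [LinearMap.adjoint_inner_right, real_inner_comm]

lemma hsSq_add_le (S T : E →ₗ[ℝ] F) : hsSq (S + T) ≤ 2 * hsSq S + 2 * hsSq T := by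
  simp only [hsSq, Finset.mul_sum, ← Finset.sum_add_distrib]
  refine Finset.sum_le_sum fun i _ => ?_
  have h := norm_add_le (S (stdOrthonormalBasis ℝ E i)) (T (stdOrthonormalBasis ℝ E i))
  rw [LinearMap.add_apply]
  nlinarith [norm_nonneg (S (stdOrthonormalBasis ℝ E i) + T (stdOrthonormalBasis ℝ E i)),
    sq_nonneg (‖S (stdOrthonormalBasis ℝ E i)‖ - ‖T (stdOrthonormalBasis ℝ E i)‖)]

lemma hsSq_neg (S : E →ₗ[ℝ] F) : hsSq (-S) = hsSq S := by simp [hsSq]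

lemma hsSq_comp_le_of_contraction {G : Type*} [NormedAddCommGroup G] [InnerProductSpace ℝ G]
    [FiniteDimensional ℝ G] (S : F →ₗ[ℝ] G) (hS : ∀ x, ‖S x‖ ≤ ‖x‖) (T : E →ₗ[ℝ] F) :
    hsSq (S ∘ₗ T) ≤ hsSq T :=
  Finset.sum_le_sum fun _ _ => pow_le_pow_left₀ (norm_nonneg _) (hS _) 2

lemma norm_adjoint_le (T : E →ₗ[ℝ] F) {c : ℝ} (hc : 0 ≤ c) (hT : ∀ x, ‖T x‖ ≤ c * ‖x‖)
    (y : F) : ‖T.adjoint y‖ ≤ c * ‖y‖ := by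
  rcases eq_or_ne (T.adjoint y) 0 with h | h
  · rw [h, norm_zero]; positivity
  · have h1 : ‖T.adjoint y‖ ^ 2 ≤ ‖y‖ * (c * ‖T.adjoint y‖) := by
      rw [← real_inner_self_eq_norm_sq, LinearMap.adjoint_inner_left]
      exact (real_inner_le_norm _ _).trans (by gcongr; exact hT _)
    have := norm_pos_iff.2 h
    nlinarith

/-- Only an orthonormal basis of `U` contributes, and each of its vectors contributes at most `c ^
2`. -/
lemma hsSq_comp_starProjection_le (T : E →ₗ[ℝ] F) (U : Submodule ℝ E) {c : ℝ}
    (hT : ∀ x, ‖T x‖ ≤ c * ‖x‖) :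
    hsSq (T ∘ₗ (U.starProjection : E →ₗ[ℝ] E)) ≤ Module.finrank ℝ U * c ^ 2 := by
  have hadj : (T ∘ₗ (U.starProjection : E →ₗ[ℝ] E)).adjoint
      = (U.starProjection : E →ₗ[ℝ] E) ∘ₗ T.adjoint := by
    refine ((LinearMap.eq_adjoint_iff _ _).2 fun x y => ?_).symm
    simp only [LinearMap.comp_apply, ContinuousLinearMap.coe_coe]
    rw [Submodule.inner_starProjection_left_eq_right, LinearMap.adjoint_inner_left]
  have key : hsSq (T ∘ₗ (U.starProjection : E →ₗ[ℝ] E))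
      = ∑ i, ‖T (stdOrthonormalBasis ℝ U i : E)‖ ^ 2 := by
    rw [← hsSq_adjoint, hadj, hsSq]
    have h1 : ∀ y : E, ‖(U.starProjection : E →ₗ[ℝ] E) y‖ ^ 2
        = ∑ i, ‖inner ℝ (stdOrthonormalBasis ℝ U i : E) y‖ ^ 2 := fun y => by
      rw [ContinuousLinearMap.coe_coe, Submodule.starProjection_apply, Submodule.norm_coe,
        ← (stdOrthonormalBasis ℝ U).sum_sq_norm_inner_right]
      refine Finset.sum_congr rfl fun i _ => ?_
      rw [Submodule.coe_inner, ← Submodule.starProjection_apply,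
        ← Submodule.inner_starProjection_left_eq_right,
        Submodule.starProjection_eq_self_iff.2 (Submodule.coe_mem _)]
    simp_rw [LinearMap.comp_apply, h1, ← (stdOrthonormalBasis ℝ F).sum_sq_norm_inner_right (T _)]
    rw [Finset.sum_comm]
    refine Finset.sum_congr rfl fun j _ => Finset.sum_congr rfl fun i _ => ?_
    rw [LinearMap.adjoint_inner_right, real_inner_comm]
  rw [key]
  calc ∑ i, ‖T (stdOrthonormalBasis ℝ U i : E)‖ ^ 2
      ≤ ∑ _i : Fin (Module.finrank ℝ U), c ^ 2 := by
        refine Finset.sum_le_sum fun i _ => ?_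
        have h := hT (stdOrthonormalBasis ℝ U i : E)
        have h1 : ‖(stdOrthonormalBasis ℝ U i : E)‖ = 1 := by
          rw [← Submodule.coe_norm]; exact (stdOrthonormalBasis ℝ U).norm_eq_one i
        rw [h1, mul_one] at h
        exact pow_le_pow_left₀ (norm_nonneg _) h 2
    _ = _ := by simp

/-- The orthogonal projection onto the span of the basis vectors with index in `I`. -/
noncomputable def coordProj {ι : Type*} [Fintype ι] (b : OrthonormalBasis ι ℝ E) (I : Finset ι) :
    E →ₗ[ℝ] E :=
  ∑ i ∈ I, (innerₛₗ ℝ (b i)).smulRight (b i)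

lemma coordProj_apply {ι : Type*} [Fintype ι] (b : OrthonormalBasis ι ℝ E) (I : Finset ι) (x : E) :
    coordProj b I x = ∑ i ∈ I, inner ℝ (b i) x • b i := by
  simp [coordProj]

lemma inner_coordProj {ι : Type*} [Fintype ι] [DecidableEq ι] (b : OrthonormalBasis ι ℝ E)
    (I : Finset ι) (x : E) (i : ι) :
    inner ℝ (b i) (coordProj b I x) = if i ∈ I then inner ℝ (b i) x else 0 := by
  rw [coordProj_apply, inner_sum]
  simp [inner_smul_right, b.inner_eq_ite]

lemma coordProj_basis {ι : Type*} [Fintype ι] [DecidableEq ι] (b : OrthonormalBasis ι ℝ E)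
    (I : Finset ι) (i : ι) :
    coordProj b I (b i) = if i ∈ I then b i else 0 := by
  rw [coordProj_apply]
  simp [b.inner_eq_ite, ite_smul]

lemma adjoint_coordProj {ι : Type*} [Fintype ι] (b : OrthonormalBasis ι ℝ E) (I : Finset ι) :
    (coordProj b I).adjoint = coordProj b I := by
  refine ((LinearMap.eq_adjoint_iff _ _).2 fun x y => ?_).symm
  simp only [coordProj_apply, sum_inner, inner_sum, inner_smul_left, inner_smul_right]
  refine Finset.sum_congr rfl fun i _ => ?_
  rw [real_inner_comm x]
  simp [mul_comm]

lemma hsSq_comp_coordProj {ι : Type*} [Fintype ι] (b : OrthonormalBasis ι ℝ E)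
    (I : Finset ι) (T : E →ₗ[ℝ] F) :
    hsSq (T ∘ₗ coordProj b I) = ∑ i ∈ I, ‖T (b i)‖ ^ 2 := by
  classical
  rw [← sum_norm_sq_eq_hsSq b, ← Finset.sum_filter_add_sum_filter_not _ (· ∈ I)]
  rw [Finset.sum_eq_zero (s := Finset.filter (fun x => x ∉ I) _), add_zero]
  · rw [Finset.filter_mem_eq_inter, Finset.univ_inter]
    exact Finset.sum_congr rfl fun i hi => by simp [coordProj_basis, hi]
  · intro i hi
    simp [coordProj_basis, (Finset.mem_filter.1 hi).2]

/-- Hard thresholding of an approximation in operator norm is adaptive in Hilbert–Schmidt norm. -/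
theorem hsSq_threshold_sub_le {ι κ : Type*} [Fintype ι] [Fintype κ]
    (M A : E →ₗ[ℝ] F) (v : OrthonormalBasis ι ℝ E) (s : ι → ℝ) (hs : ∀ i, 0 ≤ s i)
    (hM : ∀ x, ‖M x‖ ^ 2 = ∑ i, s i ^ 2 * inner ℝ (v i) x ^ 2)
    {ξ : ℝ} (hξ : 0 ≤ ξ) (hMA : ∀ x, ‖(M - A) x‖ ≤ ξ / 2 * ‖x‖)
    (a : OrthonormalBasis κ ℝ E) (J : Finset κ) (k : ℕ) (hJ : (Jᶜ : Set κ).ncard ≤ k) :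
    hsSq (M ∘ₗ coordProj v (Finset.univ.filter fun i => ξ ≤ s i) - A)
      ≤ 10 * k * ξ ^ 2 + 6 * ∑ j ∈ J, ‖A (a j)‖ ^ 2 := by
  classical
  set I : Finset ι := Finset.univ.filter fun i => ξ ≤ s i with hI
  set P := coordProj v I with hP
  set R := coordProj v Iᶜ with hR
  set tail := ∑ j ∈ J, ‖A (a j)‖ ^ 2 with htail
  have hJ' : (Jᶜ : Finset κ).card ≤ k := by
    rw [← Set.ncard_coe_finset, Finset.coe_compl]; exact hJ
  have hnorm : ∀ x, ‖x‖ ^ 2 = ∑ i, inner ℝ (v i) x ^ 2 := fun x => by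
    rw [← v.sum_sq_norm_inner_right]; simp
  have hPR : ∀ x, P x + R x = x := fun x => by
    rw [hP, hR, coordProj_apply, coordProj_apply, Finset.sum_add_sum_compl]
    exact v.sum_repr' x
  have hRle : ∀ x, ‖R x‖ ≤ ‖x‖ := fun x => by
    refine le_of_sq_le_sq ?_ (norm_nonneg _)
    rw [hnorm, hnorm]
    refine Finset.sum_le_sum fun i _ => ?_
    rw [hR, inner_coordProj]; split_ifs
    · exact le_rfl
    · simpa using sq_nonneg _
  have hMR : ∀ x, ‖M (R x)‖ ≤ ξ * ‖x‖ := fun x => by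
    refine le_of_sq_le_sq ?_ (by positivity)
    rw [hM, mul_pow, hnorm x, Finset.mul_sum]
    refine Finset.sum_le_sum fun i _ => ?_
    rw [hR, inner_coordProj]; split_ifs with h
    · have : s i < ξ := by simpa [hI] using h
      have := hs i
      gcongr
    · have := sq_nonneg (inner ℝ (v i) x); simp; positivity
  have hAR : ∀ x, ‖(A ∘ₗ R) x‖ ≤ 3 / 2 * ξ * ‖x‖ := fun x => by
    have h1 : (A ∘ₗ R) x = M (R x) - (M - A) (R x) := by simp
    rw [h1]
    refine (norm_sub_le _ _).trans ?_
    have := hMA (R x)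
    have h2 : ξ / 2 * ‖R x‖ ≤ ξ / 2 * ‖x‖ := by gcongr; exact hRle x
    linarith [hMR x]
  -- the selected directions: at most `k` plus a multiple of the tail
  have hcard : I.card * ξ ^ 2 ≤ k * ξ ^ 2 + 4 * tail := by
    let U : Submodule ℝ E := Submodule.span ℝ (Set.range fun i : I => v i)
    let Z : Submodule ℝ E := Submodule.span ℝ (Set.range fun j : J => a j)
    have hU : Module.finrank ℝ U = I.card := by
      rw [finrank_span_eq_card, Fintype.card_coe]
      exact (v.orthonormal.comp _ Subtype.val_injective).linearIndependent
    have hZ : Module.finrank ℝ Z = J.card := by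
      rw [finrank_span_eq_card, Fintype.card_coe]
      exact (a.orthonormal.comp _ Subtype.val_injective).linearIndependent
    -- `Z` has codimension at most `k`, so intersecting with it costs `U` at most `k` dimensions.
    have hdim : I.card ≤ Module.finrank ℝ (U ⊓ Z : Submodule ℝ E) + k := by
      have h1 := Submodule.finrank_sup_add_finrank_inf_eq U Z
      have h2 := Submodule.finrank_le (U ⊔ Z)
      have h3 : Module.finrank ℝ E = Fintype.card κ := Module.finrank_eq_card_basis a.toBasis
      have h4 := Finset.card_compl_add_card J
      omega
    -- On `U` the map `M` stretches by at least `ξ`, and `A` differs from it by at most `ξ / 2`. On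
    -- `U ⊓ Z` this bounds the tail of `A` from below by `ξ ^ 2 / 4` per dimension.
    have hUlow : ∀ x ∈ U, ξ / 2 * ‖x‖ ≤ ‖A x‖ := by
      intro x hx
      have hin : ∀ i ∉ I, inner ℝ (v i) x = 0 := by
        intro i hi
        induction hx using Submodule.span_induction with
        | mem y hy =>
          obtain ⟨l, rfl⟩ := hy
          have : i ≠ l := fun h => hi (h ▸ l.2)
          simp [v.inner_eq_ite, this]
        | zero => simp
        | add y z _ _ hy hz => rw [inner_add_right, hy, hz, add_zero]
        | smul c y _ hy => rw [inner_smul_right, hy, mul_zero]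
      have h1 : ξ * ‖x‖ ≤ ‖M x‖ := by
        refine le_of_sq_le_sq ?_ (norm_nonneg _)
        rw [hM, mul_pow, hnorm x, Finset.mul_sum]
        refine Finset.sum_le_sum fun i _ => ?_
        by_cases h : i ∈ I
        · have : ξ ≤ s i := by simpa [hI] using h
          gcongr
        · simp [hin i h]
      have h2 : M x = (M - A) x + A x := by simp
      have h3 := norm_add_le ((M - A) x) (A x)
      rw [← h2] at h3
      linarith [hMA x]
    have hZfix : ∀ x ∈ Z, coordProj a J x = x := by
      intro x hx
      induction hx using Submodule.span_induction with
      | mem y hy => obtain ⟨l, rfl⟩ := hy; simp [coordProj_basis]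
      | zero => simp
      | add y z _ _ hy hz => rw [map_add, hy, hz]
      | smul c y _ hy => rw [map_smul, hy]
    let e := stdOrthonormalBasis ℝ (U ⊓ Z : Submodule ℝ E)
    have he : Orthonormal ℝ fun i => (e i : E) :=
      e.orthonormal.comp_linearIsometry (U ⊓ Z).subtypeₗᵢ
    have hup := sum_orthonormal_norm_sq_le_hsSq he (A ∘ₗ coordProj a J)
    rw [hsSq_comp_coordProj] at hup
    have hlow : (Module.finrank ℝ (U ⊓ Z : Submodule ℝ E) : ℝ) * (ξ / 2) ^ 2
        ≤ ∑ i, ‖(A ∘ₗ coordProj a J) (e i)‖ ^ 2 := by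
      calc (Module.finrank ℝ (U ⊓ Z : Submodule ℝ E) : ℝ) * (ξ / 2) ^ 2
          = ∑ _i : Fin (Module.finrank ℝ (U ⊓ Z : Submodule ℝ E)), (ξ / 2) ^ 2 := by simp
        _ ≤ _ := by
          refine Finset.sum_le_sum fun i _ => ?_
          rw [LinearMap.comp_apply, hZfix _ (e i).2.2]
          have h := hUlow _ (e i).2.1
          rw [he.1 i, mul_one] at h
          gcongr
    have h5 : (I.card : ℝ) ≤ Module.finrank ℝ (U ⊓ Z : Submodule ℝ E) + k := by exact_mod_cast hdim
    nlinarith [sq_nonneg ξ]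
  -- the error on the selected directions
  have hfirst : hsSq ((M - A) ∘ₗ P) ≤ I.card * (ξ / 2) ^ 2 := by
    rw [hP, hsSq_comp_coordProj]
    calc ∑ i ∈ I, ‖(M - A) (v i)‖ ^ 2 ≤ ∑ _i ∈ I, (ξ / 2) ^ 2 := by
          refine Finset.sum_le_sum fun i _ => ?_
          have h := hMA (v i)
          rw [v.norm_eq_one, mul_one] at h
          gcongr
      _ = _ := by simp
  -- the part of `A` in the discarded directions
  have hsecond : hsSq (A ∘ₗ R) ≤ 2 * (k * (3 / 2 * ξ) ^ 2) + 2 * tail := by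
    -- `W` is the image under `A` of the at most `k` leading directions. The component in `W` has
    -- rank at most `k` and norm at most `3ξ/2`; the component in `Wᗮ` kills the leading directions
    -- and only sees the tail. Adjoints move the projection to the side where the lemmas apply.
    let W : Submodule ℝ F := Submodule.span ℝ (((Jᶜ : Finset κ).image fun j => A (a j) : Finset F))
    have hW : Module.finrank ℝ W ≤ k :=
      (finrank_span_finset_le_card _).trans (Finset.card_image_le.trans hJ')
    let PW : F →ₗ[ℝ] F := W.starProjection
    let QW : F →ₗ[ℝ] F := Wᗮ.starProjection
    have hsplit : A ∘ₗ R = PW ∘ₗ (A ∘ₗ R) + QW ∘ₗ (A ∘ₗ R) := by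
      ext x
      simp only [LinearMap.add_apply, LinearMap.comp_apply, PW, QW, ContinuousLinearMap.coe_coe]
      exact (Submodule.starProjection_add_starProjection_orthogonal (K := W) _).symm
    have hselfadj : ∀ V : Submodule ℝ F,
        (V.starProjection : F →ₗ[ℝ] F).adjoint = (V.starProjection : F →ₗ[ℝ] F) := fun V =>
      ((LinearMap.eq_adjoint_iff _ _).2 fun x y =>
        Submodule.inner_starProjection_left_eq_right V x y).symm
    have h1 : hsSq (PW ∘ₗ (A ∘ₗ R)) ≤ k * (3 / 2 * ξ) ^ 2 := by
      rw [← hsSq_adjoint, LinearMap.adjoint_comp, hselfadj]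
      refine (hsSq_comp_starProjection_le _ W
        (norm_adjoint_le _ (by positivity) hAR)).trans ?_
      gcongr
    have h2 : hsSq (QW ∘ₗ (A ∘ₗ R)) ≤ tail := by
      rw [← LinearMap.comp_assoc, ← hsSq_adjoint, LinearMap.adjoint_comp, hR, adjoint_coordProj]
      refine (hsSq_comp_le_of_contraction _ hRle _).trans ?_
      rw [hsSq_adjoint, ← sum_norm_sq_eq_hsSq a, ← Finset.sum_add_sum_compl J, htail]
      have hz : ∑ i ∈ Jᶜ, ‖(QW ∘ₗ A) (a i)‖ ^ 2 = 0 := by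
        refine Finset.sum_eq_zero fun j hj => ?_
        have hmem : A (a j) ∈ W := Submodule.subset_span (by
          rw [Finset.coe_image]; exact ⟨j, hj, rfl⟩)
        have : QW (A (a j)) = 0 :=
          (Submodule.starProjection_apply_eq_zero_iff _).2
            (by rwa [Submodule.orthogonal_orthogonal])
        rw [LinearMap.comp_apply, this]; simp
      rw [hz, add_zero]
      refine Finset.sum_le_sum fun j _ => ?_
      exact pow_le_pow_left₀ (norm_nonneg _) (Submodule.norm_starProjection_apply_le _ _) 2
    rw [hsplit]
    linarith [hsSq_add_le (PW ∘ₗ (A ∘ₗ R)) (QW ∘ₗ (A ∘ₗ R))]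
  have hdec : M ∘ₗ P - A = (M - A) ∘ₗ P + -(A ∘ₗ R) := by
    ext x
    have : A x = A (P x) + A (R x) := by rw [← map_add, hPR]
    simp [this]; abel
  rw [hdec]
  have h := hsSq_add_le ((M - A) ∘ₗ P) (-(A ∘ₗ R))
  rw [hsSq_neg] at h
  -- Selected directions give `k ξ² / 2 + 2 tail`, discarded ones `9 k ξ² + 4 tail`.
  nlinarith [sq_nonneg ξ, mul_nonneg (Nat.cast_nonneg (α := ℝ) k) (sq_nonneg ξ)]

end HilbertSchmidt

/-! ### Translation to matrices and their singular values. -/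

lemma frobSq_eq_hsSq {m d : ℕ} (M : Matrix (Fin m) (Fin d) ℝ) :
    frobSq M = hsSq (Matrix.toLpLin 2 2 M) := by
  rw [← sum_norm_sq_eq_hsSq (EuclideanSpace.basisFun (Fin d) ℝ), frobSq, Finset.sum_comm]
  refine Finset.sum_congr rfl fun j _ => ?_
  rw [EuclideanSpace.real_norm_sq_eq]
  refine Finset.sum_congr rfl fun i _ => ?_
  simp [Matrix.toLpLin_apply]

/-- Spectral theorem for `Mᴴ M`; this supplies the hypothesis `hM` of `hsSq_threshold_sub_le` for an
unordered eigenbasis. -/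
lemma norm_sq_toLpLin_eigenvectorBasis {m d : ℕ} (M : Matrix (Fin m) (Fin d) ℝ)
    (x : EuclideanSpace ℝ (Fin d)) :
    ‖Matrix.toLpLin 2 2 M x‖ ^ 2 = ∑ i,
      √((Matrix.isHermitian_conjTranspose_mul_self M).eigenvalues i) ^ 2 *
        inner ℝ ((Matrix.isHermitian_conjTranspose_mul_self M).eigenvectorBasis i) x ^ 2 := by
  set h := Matrix.isHermitian_conjTranspose_mul_self M
  have hpos : ∀ i, 0 ≤ h.eigenvalues i := (Matrix.posSemidef_conjTranspose_mul_self M).eigenvalues_nonneg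
  have h1 : ‖Matrix.toLpLin 2 2 M x‖ ^ 2 = inner ℝ x (Matrix.toLpLin 2 2 (Mᴴ * M) x) := by
    rw [← real_inner_self_eq_norm_sq]
    simp only [EuclideanSpace.inner_eq_star_dotProduct, Matrix.toLpLin_apply, star_trivial,
      Matrix.conjTranspose_eq_transpose_of_trivial]
    rw [dotProduct_comm (_ *ᵥ _) x.ofLp, ← Matrix.mulVec_mulVec, Matrix.dotProduct_mulVec x.ofLp Mᵀ,
      Matrix.vecMul_transpose]
  have h2 : Matrix.toLpLin 2 2 (Mᴴ * M) x
      = ∑ i, inner ℝ (h.eigenvectorBasis i) x • (h.eigenvalues i • h.eigenvectorBasis i) := by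
    conv_lhs => rw [← h.eigenvectorBasis.sum_repr' x]
    rw [map_sum]
    refine Finset.sum_congr rfl fun i _ => ?_
    rw [map_smul, Matrix.toLpLin_apply, h.mulVec_eigenvectorBasis]
    rfl
  rw [h1, h2, inner_sum]
  refine Finset.sum_congr rfl fun i _ => ?_
  rw [inner_smul_right, inner_smul_right, Real.sq_sqrt (hpos i), real_inner_comm x]
  ring

/-- Since `s_i u_i = M v_i`, thresholding is precomposition with a projection, and left singular
vectors are never needed. -/
lemma toLpLin_svThreshold {m d : ℕ} (M : Matrix (Fin m) (Fin d) ℝ) (ξ : ℝ) :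
    Matrix.toLpLin 2 2 (svThreshold ξ M) = Matrix.toLpLin 2 2 M ∘ₗ
      coordProj (Matrix.isHermitian_conjTranspose_mul_self M).eigenvectorBasis
        (Finset.univ.filter fun i =>
          ξ ≤ √((Matrix.isHermitian_conjTranspose_mul_self M).eigenvalues i)) := by
  ext1 x
  rw [LinearMap.comp_apply, coordProj_apply, map_sum, svThreshold, Finset.sum_filter, map_sum,
    LinearMap.sum_apply]
  refine Finset.sum_congr rfl fun i _ => ?_
  split_ifs with hi
  · rw [map_smul]
    ext j
    simp [Matrix.toLpLin_apply, Matrix.vecMulVec_mulVec, EuclideanSpace.inner_eq_star_dotProduct,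
      dotProduct_comm]
  · simp

/-- Mathlib's eigenbasis of `A* A` is indexed in the same decreasing order as `singularValues`, so
the tail beyond `k` is a set of basis indices. -/
lemma exists_singular_basis {m d : ℕ} (A : Matrix (Fin m) (Fin d) ℝ) :
    ∃ a : OrthonormalBasis (Fin d) ℝ (EuclideanSpace ℝ (Fin d)),
      ∀ j : Fin d, ‖Matrix.toLpLin 2 2 A (a j)‖ ^ 2 = singularValue A j ^ 2 := by
  set T := Matrix.toLpLin 2 2 A with hT
  have hn : Module.finrank ℝ (EuclideanSpace ℝ (Fin d)) = d := by simp
  refine ⟨T.isSymmetric_adjoint_comp_self.eigenvectorBasis hn, fun j => ?_⟩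
  rw [singularValue, LinearMap.sq_singularValues_fin _ hn j, ← real_inner_self_eq_norm_sq,
    ← LinearMap.adjoint_inner_left, ← LinearMap.comp_apply,
    LinearMap.IsSymmetric.apply_eigenvectorBasis, inner_smul_left]
  simp

/-- The oracle inequality for hard thresholding of the singular values. -/
theorem frobSq_svThreshold_sub_le {m d : ℕ} (M A : Matrix (Fin m) (Fin d) ℝ) {ξ : ℝ} (hξ : 0 ≤ ξ)
    (hMA : ∀ x, ‖Matrix.toLpLin 2 2 (M - A) x‖ ≤ ξ / 2 * ‖x‖) (k : ℕ) :
    frobSq (svThreshold ξ M - A)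
      ≤ 10 * k * ξ ^ 2 + 6 * ∑ i ∈ Finset.Ico k d, singularValue A i ^ 2 := by
  obtain ⟨a, ha⟩ := exists_singular_basis A
  set J : Finset (Fin d) := Finset.univ.filter fun j => k ≤ (j : ℕ) with hJ
  have hcard : ((J : Set (Fin d))ᶜ).ncard ≤ k := by
    have hinj : Set.InjOn (fun j : Fin d => (j : ℕ)) ((J : Set (Fin d))ᶜ) :=
      Fin.val_injective.injOn
    have := Set.ncard_le_ncard_of_injOn (t := (Finset.range k : Set ℕ)) (fun j : Fin d => (j : ℕ))
      (fun j hj => by simpa [hJ] using hj) hinj (Finset.finite_toSet _)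
    rwa [Set.ncard_coe_finset, Finset.card_range] at this
  have h := hsSq_threshold_sub_le (Matrix.toLpLin 2 2 M) (Matrix.toLpLin 2 2 A)
    (Matrix.isHermitian_conjTranspose_mul_self M).eigenvectorBasis _ (fun _ => Real.sqrt_nonneg _)
    (norm_sq_toLpLin_eigenvectorBasis M) hξ (by rwa [← map_sub]) a J k hcard
  rw [← toLpLin_svThreshold, ← map_sub, ← frobSq_eq_hsSq] at h
  refine h.trans_eq ?_
  congr 2
  refine Finset.sum_bij (fun j _ => (j : ℕ)) (fun j hj => ?_) (fun _ _ _ _ h => Fin.val_injective h)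
    (fun i hi => ?_) (fun j _ => ha j)
  · have : k ≤ (j : ℕ) := by simpa [hJ] using hj
    simp [this]
  · have := Finset.mem_Ico.1 hi
    exact ⟨⟨i, this.2⟩, by simp [hJ, this.1], rfl⟩

/-! ### Exponential supermartingales along independent noise. -/

section Adapted

variable {Ω : Type*} [MeasurableSpace Ω] {P : Measure Ω} [IsProbabilityMeasure P]
  {E F : Type*} [mE : MeasurableSpace E] [MeasurableSpace F] {η : ℕ → Ω → E}

/-- The σ-algebra generated by the noise before time `t`. -/
abbrev past (η : ℕ → Ω → E) (t : ℕ) : MeasurableSpace Ω :=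
  ⨆ s ∈ {s | s < t}, MeasurableSpace.comap (η s) mE

lemma past_le (hm : ∀ t, Measurable (η t)) (t : ℕ) : past η t ≤ ‹MeasurableSpace Ω› :=
  iSup₂_le fun s _ => (hm s).comap_le

lemma past_mono {s t : ℕ} (h : s ≤ t) : past η s ≤ past η t :=
  biSup_mono fun _ hr => lt_of_lt_of_le hr h

lemma measurable_past {s t : ℕ} (h : s < t) : Measurable[past η t] (η s) :=
  (comap_measurable (η s)).mono (le_biSup (fun s => MeasurableSpace.comap (η s) mE) h) le_rfl

lemma indep_past (hm : ∀ t, Measurable (η t)) (hi : iIndepFun η P) (t : ℕ) :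
    Indep (past η t) (MeasurableSpace.comap (η t) mE) P := by
  have h := indep_iSup_of_disjoint (fun s => (hm s).comap_le) hi
    (S := {s | s < t}) (T := {t}) (by simp)
  simpa [past] using h

/-- The first `n` factors and `Z n` are functions of the past, hence independent of `η n`. Fubini
integrates out `η n` with the past frozen, and `h1` bounds that integral by 1. Working with `∫⁻`
avoids conditional expectations and integrability. -/
theorem lintegral_prod_adapted_le_one (hm : ∀ t, Measurable (η t)) (hi : iIndepFun η P)
    {Z : ℕ → Ω → F} (hZ : ∀ t, Measurable[past η t] (Z t)) {g : ℕ → F → E → ℝ≥0∞}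
    (hg : ∀ t, Measurable (Function.uncurry (g t)))
    (h1 : ∀ t z, ∫⁻ ω, g t z (η t ω) ∂P ≤ 1) (n : ℕ) :
    ∫⁻ ω, ∏ t ∈ Finset.range n, g t (Z t ω) (η t ω) ∂P ≤ 1 := by
  induction n with
  | zero => simp
  | succ n ih =>
    set W : Ω → ℝ≥0∞ := fun ω => ∏ t ∈ Finset.range n, g t (Z t ω) (η t ω) with hW
    have hWm : Measurable[past η n] W := by
      refine Finset.measurable_fun_prod _ fun t ht => ?_
      have htn : t < n := Finset.mem_range.1 ht
      exact (hg t).comp (((hZ t).mono (past_mono htn.le) le_rfl).prodMk (measurable_past htn))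
    have hX : Measurable[past η n] fun ω => (W ω, Z n ω) := hWm.prodMk (hZ n)
    have hX' : Measurable fun ω => (W ω, Z n ω) := hX.mono (past_le hm n) le_rfl
    have hind : IndepFun (fun ω => (W ω, Z n ω)) (η n) P :=
      indep_of_indep_of_le_left (indep_past hm hi n) hX.comap_le
    have hmap := (indepFun_iff_map_prod_eq_prod_map_map hX'.aemeasurable (hm n).aemeasurable).1 hind
    let G : (ℝ≥0∞ × F) × E → ℝ≥0∞ := fun p => p.1.1 * g n p.1.2 p.2
    have hG : Measurable G := (measurable_fst.comp measurable_fst).mul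
      ((hg n).comp ((measurable_snd.comp measurable_fst).prodMk measurable_snd))
    calc ∫⁻ ω, ∏ t ∈ Finset.range (n + 1), g t (Z t ω) (η t ω) ∂P
        = ∫⁻ ω, G ((W ω, Z n ω), η n ω) ∂P := by simp only [Finset.prod_range_succ, G, hW]
      _ = ∫⁻ p, G p ∂((P.map fun ω => (W ω, Z n ω)).prod (P.map (η n))) := by
          rw [← hmap, lintegral_map hG (hX'.prodMk (hm n))]
      _ = ∫⁻ a, ∫⁻ e, G (a, e) ∂(P.map (η n)) ∂(P.map fun ω => (W ω, Z n ω)) :=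
          lintegral_prod _ hG.aemeasurable
      _ ≤ ∫⁻ a, a.1 ∂(P.map fun ω => (W ω, Z n ω)) := by
          refine lintegral_mono fun a => ?_
          have hga : Measurable fun e => g n a.2 e := (hg n).comp measurable_prodMk_left
          simp only [G]
          rw [lintegral_const_mul _ hga, lintegral_map hga (hm n)]
          exact mul_le_of_le_one_right' (h1 n a.2)
      _ = ∫⁻ ω, W ω ∂P := lintegral_map measurable_fst hX'
      _ ≤ 1 := ih

/-- Markov's inequality for the exponential of the sum. -/
theorem measure_sum_adapted_ge_le (hm : ∀ t, Measurable (η t)) (hi : iIndepFun η P)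
    {Z : ℕ → Ω → F} (hZ : ∀ t, Measurable[past η t] (Z t)) {h : ℕ → F → E → ℝ}
    (hh : ∀ t, Measurable (Function.uncurry (h t)))
    (h1 : ∀ t z, ∫⁻ ω, ENNReal.ofReal (Real.exp (h t z (η t ω))) ∂P ≤ 1) (n : ℕ) (τ : ℝ) :
    P {ω | τ ≤ ∑ t ∈ Finset.range n, h t (Z t ω) (η t ω)} ≤ ENNReal.ofReal (Real.exp (-τ)) := by
  have hZm : ∀ t, Measurable (Z t) := fun t => (hZ t).mono (past_le hm t) le_rfl
  have h2 := lintegral_prod_adapted_le_one hm hi hZ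
    (g := fun t z e => ENNReal.ofReal (Real.exp (h t z e))) (fun t => by
      exact (Real.measurable_exp.comp (hh t)).ennreal_ofReal) h1 n
  have h3 : ∀ ω, ∏ t ∈ Finset.range n, ENNReal.ofReal (Real.exp (h t (Z t ω) (η t ω)))
      = ENNReal.ofReal (Real.exp (∑ t ∈ Finset.range n, h t (Z t ω) (η t ω))) := fun ω => by
    rw [Real.exp_sum, ENNReal.ofReal_prod_of_nonneg fun _ _ => (Real.exp_pos _).le]
  simp_rw [h3] at h2
  have hmeas : Measurable fun ω => ∑ t ∈ Finset.range n, h t (Z t ω) (η t ω) :=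
    Finset.measurable_fun_sum _ fun t _ => (hh t).comp ((hZm t).prodMk (hm t))
  have h4 := mul_meas_ge_le_lintegral (μ := P)
    (f := fun ω => ENNReal.ofReal (Real.exp (∑ t ∈ Finset.range n, h t (Z t ω) (η t ω))))
    (Real.measurable_exp.comp hmeas).ennreal_ofReal (ENNReal.ofReal (Real.exp τ))
  have h5 : {ω | τ ≤ ∑ t ∈ Finset.range n, h t (Z t ω) (η t ω)} = {ω | ENNReal.ofReal (Real.exp τ)
      ≤ ENNReal.ofReal (Real.exp (∑ t ∈ Finset.range n, h t (Z t ω) (η t ω)))} := by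
    ext ω
    simp [ENNReal.ofReal_le_ofReal_iff (Real.exp_pos _).le]
  rw [h5, Real.exp_neg, ENNReal.ofReal_inv_of_pos (Real.exp_pos _), ← one_div,
    ENNReal.le_div_iff_mul_le (by simp [Real.exp_pos]) (by simp), mul_comm]
  exact h4.trans h2

/-- A union bound over finitely many exponential supermartingales. -/
theorem exists_measurableSet_forall_sum_adapted_lt (hm : ∀ t, Measurable (η t))
    (hi : iIndepFun η P) {Z : ℕ → Ω → F} (hZ : ∀ t, Measurable[past η t] (Z t))
    (S : Finset (ℕ × (ℕ → F → E → ℝ)))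
    (hh : ∀ h ∈ S, ∀ t, Measurable (Function.uncurry (h.2 t)))
    (h1 : ∀ h ∈ S, ∀ t z, ∫⁻ ω, ENNReal.ofReal (Real.exp (h.2 t z (η t ω))) ∂P ≤ 1)
    (τ δ : ℝ) (hδ : 0 ≤ δ) (hS : S.card * Real.exp (-τ) ≤ δ) :
    ∃ G : Set Ω, MeasurableSet G ∧ ENNReal.ofReal (1 - δ) ≤ P G ∧
      ∀ ω ∈ G, ∀ h ∈ S, ∑ t ∈ Finset.range h.1, h.2 t (Z t ω) (η t ω) < τ := by
  have hZm : ∀ t, Measurable (Z t) := fun t => (hZ t).mono (past_le hm t) le_rfl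
  set B : Set Ω := ⋃ h ∈ S, {ω | τ ≤ ∑ t ∈ Finset.range h.1, h.2 t (Z t ω) (η t ω)} with hB
  have hBm : MeasurableSet B := by
    refine S.measurableSet_biUnion fun h hS => measurableSet_le measurable_const ?_
    exact Finset.measurable_fun_sum _ fun t _ => (hh h hS t).comp ((hZm t).prodMk (hm t))
  have hPB : P B ≤ ENNReal.ofReal δ := by
    refine (measure_biUnion_finset_le _ _).trans ?_
    refine (Finset.sum_le_sum fun h hS =>
      measure_sum_adapted_ge_le hm hi hZ (hh h hS) (h1 h hS) h.1 τ).trans ?_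
    rw [Finset.sum_const, nsmul_eq_mul, ← ENNReal.ofReal_natCast,
      ← ENNReal.ofReal_mul (Nat.cast_nonneg _)]
    exact ENNReal.ofReal_le_ofReal hS
  refine ⟨Bᶜ, hBm.compl, ?_, fun ω hω h hhS => ?_⟩
  · rw [prob_compl_eq_one_sub hBm, ENNReal.ofReal_sub _ hδ, ENNReal.ofReal_one]
    exact tsub_le_tsub_left hPB 1
  · by_contra hcon
    exact hω (Set.mem_biUnion hhS (not_lt.1 hcon))

end Adapted

/-- The state at time `t` uses only the noise strictly before `t`: it is predictable relative to `η
t`. -/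
lemma measurable_trajectory {Ω : Type*} [MeasurableSpace Ω] {d : ℕ} (A : Matrix (Fin d) (Fin d) ℝ)
    (η : ℕ → Ω → Fin d → ℝ) (t : ℕ) :
    Measurable[past η t] fun ω => trajectory A (fun s => η s ω) t := by
  induction t with
  | zero => exact measurable_const
  | succ t ih =>
    have hA : Measurable fun x : Fin d → ℝ => A *ᵥ x :=
      (Matrix.mulVecLin A).continuous_of_finiteDimensional.measurable
    exact (hA.comp (ih.mono (past_mono t.le_succ) le_rfl)).add (measurable_past t.lt_succ_self)

/-! ### Exponential moments of subgaussian variables. -/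

section SubGaussian

variable {Ω : Type*} [MeasurableSpace Ω] {P : Measure Ω} [IsProbabilityMeasure P]

lemma lintegral_exp_le_of_subgaussian {z : Ω → ℝ} {s : ℝ≥0} (hz : HasSubgaussianMGF z s P)
    (l : ℝ) : ∫⁻ ω, ENNReal.ofReal (Real.exp (l * z ω)) ∂P
      ≤ ENNReal.ofReal (Real.exp (s * l ^ 2 / 2)) := by
  rw [← ofReal_integral_eq_lintegral_ofReal (hz.integrable_exp_mul l)
    (ae_of_all _ fun _ => (Real.exp_pos _).le)]
  exact ENNReal.ofReal_le_ofReal (hz.mgf_le l)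

lemma lintegral_exp_sub_le_one_of_subgaussian {z : Ω → ℝ} {s : ℝ≥0}
    (hz : HasSubgaussianMGF z s P) (l : ℝ) :
    ∫⁻ ω, ENNReal.ofReal (Real.exp (l * z ω - s * l ^ 2 / 2)) ∂P ≤ 1 := by
  simp_rw [sub_eq_add_neg, Real.exp_add, ENNReal.ofReal_mul (Real.exp_pos _).le]
  rw [lintegral_mul_const' _ _ ENNReal.ofReal_ne_top]
  refine (mul_le_mul_left (lintegral_exp_le_of_subgaussian hz l) _).trans ?_
  rw [← ENNReal.ofReal_mul (Real.exp_pos _).le, ← Real.exp_add]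
  simp

end SubGaussian

/-! ### Exponential moments of squares of subgaussian variables. -/

section SubExponential

variable {Ω : Type*} [MeasurableSpace Ω] {P : Measure Ω} [IsProbabilityMeasure P]

lemma lintegral_exp_mul_gaussianReal (c : ℝ) :
    ∫⁻ g, ENNReal.ofReal (Real.exp (c * g)) ∂(gaussianReal 0 1)
      = ENNReal.ofReal (Real.exp (c ^ 2 / 2)) := by
  rw [← ofReal_integral_eq_lintegral_ofReal (integrable_exp_mul_gaussianReal c)
    (ae_of_all _ fun _ => (Real.exp_pos _).le)]
  have h := congrFun (mgf_id_gaussianReal (μ := 0) (v := 1)) c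
  simp only [mgf, id] at h
  rw [h]; simp

lemma lintegral_exp_sq_gaussianReal :
    ∫⁻ g, ENNReal.ofReal (Real.exp (g ^ 2 / 4)) ∂(gaussianReal 0 1) = ENNReal.ofReal √2 := by
  rw [gaussianReal_of_var_ne_zero _ one_ne_zero, lintegral_withDensity_eq_lintegral_mul _
    (measurable_gaussianPDF _ _) (by fun_prop)]
  have h : ∀ g : ℝ, (gaussianPDF 0 1 * fun g => ENNReal.ofReal (Real.exp (g ^ 2 / 4))) g
      = ENNReal.ofReal ((√(2 * Real.pi))⁻¹ * Real.exp (-(1 / 4) * g ^ 2)) := fun g => by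
    simp only [Pi.mul_apply, gaussianPDF, gaussianPDFReal]
    rw [← ENNReal.ofReal_mul (by positivity), mul_assoc, ← Real.exp_add]
    congr 3
    · simp
    · simp; ring
  simp_rw [h]
  rw [← ofReal_integral_eq_lintegral_ofReal
    ((integrable_exp_neg_mul_sq (by norm_num)).const_mul _) (ae_of_all _ fun _ => by positivity),
    integral_const_mul, integral_gaussian]
  congr 1
  rw [← Real.sqrt_inv, ← Real.sqrt_mul (by positivity)]
  congr 1
  field_simp
  norm_num

/-- The square of a subgaussian variable has an exponential moment. -/
lemma lintegral_exp_sq_le {z : Ω → ℝ} (hzm : Measurable z) {s : ℝ≥0} (hs : 0 < s)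
    (hz : HasSubgaussianMGF z s P) :
    ∫⁻ ω, ENNReal.ofReal (Real.exp (z ω ^ 2 / (4 * s))) ∂P ≤ ENNReal.ofReal √2 := by
  have hs' : (0 : ℝ) < s := hs
  -- Gaussian linearisation: for standard Gaussian `g`, `exp (z²/(4s)) = E_g exp (a z g)`. After
  -- exchanging expectations, subgaussianity of `z` bounds the inner one by `exp (s a² g² / 2) = exp
  -- (g²/4)`.
  set a : ℝ := (√(2 * s))⁻¹ with ha
  have ha2 : a ^ 2 = 1 / (2 * s) := by
    rw [ha, inv_pow, Real.sq_sqrt (by positivity), one_div]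
  calc ∫⁻ ω, ENNReal.ofReal (Real.exp (z ω ^ 2 / (4 * s))) ∂P
      = ∫⁻ ω, ∫⁻ g, ENNReal.ofReal (Real.exp (a * z ω * g)) ∂(gaussianReal 0 1) ∂P := by
        refine lintegral_congr fun ω => ?_
        rw [lintegral_exp_mul_gaussianReal, mul_pow, ha2]
        congr 2; field_simp; ring
    _ = ∫⁻ g, ∫⁻ ω, ENNReal.ofReal (Real.exp (a * z ω * g)) ∂P ∂(gaussianReal 0 1) :=
        lintegral_lintegral_swap (by fun_prop)
    _ ≤ ∫⁻ g, ENNReal.ofReal (Real.exp (g ^ 2 / 4)) ∂(gaussianReal 0 1) := by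
        refine lintegral_mono fun g => ?_
        have h := lintegral_exp_le_of_subgaussian hz (a * g)
        rw [mul_pow, ha2] at h
        refine le_trans (le_of_eq ?_) (h.trans_eq ?_)
        · refine lintegral_congr fun ω => ?_
          ring_nf
        · congr 2; field_simp; ring
    _ = _ := lintegral_exp_sq_gaussianReal

lemma integrable_exp_sq {z : Ω → ℝ} (hzm : Measurable z) {s : ℝ≥0} (hs : 0 < s)
    (hz : HasSubgaussianMGF z s P) :
    Integrable (fun ω => Real.exp (z ω ^ 2 / (4 * s))) P := by
  refine ⟨by fun_prop, ?_⟩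
  rw [hasFiniteIntegral_iff_ofReal (ae_of_all _ fun _ => (Real.exp_pos _).le)]
  exact (lintegral_exp_sq_le hzm hs hz).trans_lt ENNReal.ofReal_lt_top

lemma integral_exp_sq_le {z : Ω → ℝ} (hzm : Measurable z) {s : ℝ≥0} (hs : 0 < s)
    (hz : HasSubgaussianMGF z s P) :
    ∫ ω, Real.exp (z ω ^ 2 / (4 * s)) ∂P ≤ √2 := by
  have h := lintegral_exp_sq_le hzm hs hz
  rw [← ofReal_integral_eq_lintegral_ofReal (integrable_exp_sq hzm hs hz)
    (ae_of_all _ fun _ => (Real.exp_pos _).le)] at h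
  exact (ENNReal.ofReal_le_ofReal_iff (by positivity)).1 h

lemma integrable_sq_of_subgaussian {z : Ω → ℝ} {s : ℝ≥0} (hz : HasSubgaussianMGF z s P) :
    Integrable (fun ω => z ω ^ 2) P := (hz.memLp 2).integrable_sq

lemma sqrt_two_lt : √2 < 3 / 2 := by
  rw [Real.sqrt_lt' (by norm_num)]; norm_num

/-- Take expectations in `x + 1 ≤ exp x` at `x = z²/(4s)` and use `√2 - 1 < 1/2`. -/
lemma integral_sq_le_of_subgaussian {z : Ω → ℝ} (hzm : Measurable z) {s : ℝ≥0} (hs : 0 < s)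
    (hz : HasSubgaussianMGF z s P) : ∫ ω, z ω ^ 2 ∂P ≤ 2 * s := by
  have hs' : (0 : ℝ) < s := hs
  have h1 : ∫ ω, (z ω ^ 2 / (4 * s) + 1) ∂P ≤ ∫ ω, Real.exp (z ω ^ 2 / (4 * s)) ∂P :=
    integral_mono (((integrable_sq_of_subgaussian hz).div_const _).add (integrable_const _))
      (integrable_exp_sq hzm hs hz) fun ω => Real.add_one_le_exp _
  rw [integral_add ((integrable_sq_of_subgaussian hz).div_const _) (integrable_const _),
    integral_div] at h1
  simp only [integral_const, probReal_univ, smul_eq_mul, mul_one] at h1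
  have h2 := h1.trans (integral_exp_sq_le hzm hs hz)
  have h3 : (∫ ω, z ω ^ 2 ∂P) / (4 * s) ≤ 1 / 2 := by linarith [sqrt_two_lt]
  rw [div_le_iff₀ (by positivity)] at h3
  linarith

lemma exp_le_one_add_add_sq_mul_exp_abs (x : ℝ) :
    Real.exp x ≤ 1 + x + x ^ 2 * Real.exp |x| := by
  have h1 : (1 : ℝ) ≤ Real.exp |x| := Real.one_le_exp (abs_nonneg x)
  rcases le_total |x| 1 with h | h
  · have := (abs_le.1 (Real.abs_exp_sub_one_sub_id_le h)).2
    nlinarith [sq_nonneg x]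
  · rcases le_total 0 x with h0 | h0
    · rw [abs_of_nonneg h0] at *
      nlinarith [Real.exp_pos x, mul_nonneg (Real.exp_pos x).le (by nlinarith : (0:ℝ) ≤ x ^ 2 - 1)]
    · have : Real.exp x ≤ 1 := Real.exp_le_one_iff.2 h0
      rw [abs_of_nonpos h0] at *
      nlinarith [sq_nonneg x]

/-- The centred square of a subgaussian variable is subexponential. -/
theorem lintegral_exp_centred_sq_le_one {z : Ω → ℝ} (hzm : Measurable z) {s : ℝ≥0} (hs : 0 < s)
    (hz : HasSubgaussianMGF z s P) {l : ℝ} (hl : |l| ≤ 1 / (8 * s)) :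
    ∫⁻ ω, ENNReal.ofReal (Real.exp (l * (z ω ^ 2 - ∫ ω, z ω ^ 2 ∂P) - 512 * (s * l) ^ 2)) ∂P
      ≤ 1 := by
  have hs' : (0 : ℝ) < s := hs
  set m := ∫ ω, z ω ^ 2 ∂P with hm
  have hm0 : 0 ≤ m := integral_nonneg fun ω => sq_nonneg _
  have hm2 : m ≤ 2 * s := integral_sq_le_of_subgaussian hzm hs hz
  have hexp_half : Real.exp (1 / 2) ≤ 2 := by
    have h := Real.exp_one_lt_d9
    have h2 : Real.exp (1 / 2) ^ 2 = Real.exp 1 := by rw [← Real.exp_nat_mul]; norm_num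
    nlinarith [Real.exp_pos (1 / 2)]
  -- Second-order expansion whose linear term has mean zero. Here `256 = 128 · 2`: `128` from `t²/2
  -- ≤ exp t` at `t = |y|/(8s)`, and `2` bounds `exp (1/2)`, the cost of `m ≤ 2s`. Integration adds
  -- the factor `√2 ≤ 2`, whence `512`.
  have hpt : ∀ ω, Real.exp (l * (z ω ^ 2 - m))
      ≤ 1 + l * (z ω ^ 2 - m) + 256 * (s * l) ^ 2 * Real.exp (z ω ^ 2 / (4 * s)) := by
    intro ω
    set y := z ω ^ 2 - m with hy
    have hy1 : |y| ≤ z ω ^ 2 + m := by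
      rw [abs_le]; constructor <;> nlinarith [sq_nonneg (z ω)]
    refine (exp_le_one_add_add_sq_mul_exp_abs _).trans ?_
    gcongr 1 + l * y + ?_
    have h1 : y ^ 2 ≤ 128 * s ^ 2 * Real.exp (|y| / (8 * s)) := by
      have h := Real.quadratic_le_exp_of_nonneg (x := |y| / (8 * s)) (by positivity)
      have h0 : 0 ≤ |y| / (8 * s) := by positivity
      have h2 : y ^ 2 = 64 * s ^ 2 * (|y| / (8 * s)) ^ 2 := by
        rw [div_pow, sq_abs]; field_simp; ring
      rw [h2]
      nlinarith [sq_pos_of_pos hs']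
    have h2 : |l * y| ≤ |y| / (8 * s) := by
      rw [abs_mul]
      calc |l| * |y| ≤ 1 / (8 * s) * |y| := by gcongr
        _ = _ := by ring
    have h3 : Real.exp (|y| / (8 * s)) * Real.exp (|y| / (8 * s))
        ≤ 2 * Real.exp (z ω ^ 2 / (4 * s)) := by
      rw [← Real.exp_add]
      calc Real.exp (|y| / (8 * s) + |y| / (8 * s))
          ≤ Real.exp (1 / 2 + z ω ^ 2 / (4 * s)) := by
            apply Real.exp_le_exp.2
            have e1 : |y| / (8 * s) + |y| / (8 * s) = |y| / (4 * s) := by field_simp; ring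
            have e2 : 1 / 2 + z ω ^ 2 / (4 * s) = (2 * s + z ω ^ 2) / (4 * s) := by
              field_simp; ring
            rw [e1, e2]
            gcongr; linarith
        _ ≤ _ := by rw [Real.exp_add]; gcongr
    calc (l * y) ^ 2 * Real.exp |l * y|
        ≤ l ^ 2 * (128 * s ^ 2 * Real.exp (|y| / (8 * s))) * Real.exp (|y| / (8 * s)) := by
          rw [mul_pow]; gcongr
      _ = 128 * (s * l) ^ 2 * (Real.exp (|y| / (8 * s)) * Real.exp (|y| / (8 * s))) := by ring
      _ ≤ 128 * (s * l) ^ 2 * (2 * Real.exp (z ω ^ 2 / (4 * s))) := by gcongr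
      _ = _ := by ring
  have hi2 := integrable_sq_of_subgaussian hz
  have hie := integrable_exp_sq hzm hs hz
  have hic : Integrable (fun ω => l * (z ω ^ 2 - m)) P :=
    (hi2.sub (integrable_const _)).const_mul _
  have hic1 : Integrable (fun ω => 1 + l * (z ω ^ 2 - m)) P := (integrable_const _).add hic
  have hir : Integrable (fun ω => 1 + l * (z ω ^ 2 - m)
      + 256 * (s * l) ^ 2 * Real.exp (z ω ^ 2 / (4 * s))) P :=
    hic1.add (hie.const_mul _)
  have hi : Integrable (fun ω => Real.exp (l * (z ω ^ 2 - m))) P := by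
    refine hir.mono' (by fun_prop) (ae_of_all _ fun ω => ?_)
    rw [Real.norm_of_nonneg (Real.exp_pos _).le]
    exact hpt ω
  have hle : ∫ ω, Real.exp (l * (z ω ^ 2 - m)) ∂P ≤ Real.exp (512 * (s * l) ^ 2) := by
    refine (integral_mono hi hir hpt).trans ?_
    rw [integral_add hic1 (hie.const_mul _),
      integral_add (integrable_const _) hic, integral_const_mul, integral_const_mul,
      integral_sub hi2 (integrable_const _)]
    simp only [integral_const, probReal_univ, smul_eq_mul, mul_one, one_mul, ← hm, sub_self,
      mul_zero, add_zero]
    have h1 := integral_exp_sq_le hzm hs hz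
    have h2 := Real.add_one_le_exp (512 * (s * l) ^ 2)
    nlinarith [sqrt_two_lt, sq_nonneg (s * l)]
  simp_rw [Real.exp_sub]
  rw [← ofReal_integral_eq_lintegral_ofReal (hi.div_const _)
    (ae_of_all _ fun _ => by positivity), integral_div]
  rw [← ENNReal.ofReal_one]
  refine ENNReal.ofReal_le_ofReal ?_
  rwa [div_le_one (Real.exp_pos _)]

end SubExponential

/-! ### Euclidean length, nets and extreme eigenvalues. -/

section Nets

variable {d : ℕ}

/-- The Euclidean length of a vector. -/
noncomputable def len (x : Fin d → ℝ) : ℝ := ‖(WithLp.toLp 2 x : EuclideanSpace ℝ (Fin d))‖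

lemma len_nonneg (x : Fin d → ℝ) : 0 ≤ len x := norm_nonneg _

lemma dotProduct_eq_inner (x y : Fin d → ℝ) :
    x ⬝ᵥ y = inner ℝ (WithLp.toLp 2 x : EuclideanSpace ℝ (Fin d)) (WithLp.toLp 2 y) := by
  simp [EuclideanSpace.inner_eq_star_dotProduct, dotProduct_comm]

lemma len_sq (x : Fin d → ℝ) : len x ^ 2 = x ⬝ᵥ x := by
  rw [dotProduct_eq_inner, real_inner_self_eq_norm_sq, len]

lemma dotProduct_le_len (x y : Fin d → ℝ) : x ⬝ᵥ y ≤ len x * len y := by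
  rw [dotProduct_eq_inner]; exact real_inner_le_norm _ _

lemma len_eq_zero {x : Fin d → ℝ} : len x = 0 ↔ x = 0 := by
  rw [len, norm_eq_zero, WithLp.toLp_eq_zero]

lemma len_smul (c : ℝ) (x : Fin d → ℝ) : len (c • x) = |c| * len x := by
  rw [len, WithLp.toLp_smul, norm_smul, Real.norm_eq_abs, len]

lemma len_add_le (x y : Fin d → ℝ) : len (x + y) ≤ len x + len y := by
  rw [len, WithLp.toLp_add]; exact norm_add_le _ _

lemma len_le_of_forall_dotProduct_le {x : Fin d → ℝ} {c : ℝ} (hc : 0 ≤ c)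
    (h : ∀ y, y ⬝ᵥ x ≤ c * len y) : len x ≤ c := by
  have h1 := h x
  rw [← len_sq] at h1
  by_contra hcon
  push Not at hcon
  nlinarith [len_nonneg x]

lemma opNorm_nonneg (M : Matrix (Fin d) (Fin d) ℝ) : 0 ≤ opNorm M := norm_nonneg _

lemma len_mulVec_le (M : Matrix (Fin d) (Fin d) ℝ) (x : Fin d → ℝ) :
    len (M *ᵥ x) ≤ opNorm M * len x := by
  rw [len, ← Matrix.toEuclideanCLM_toLp]
  exact ContinuousLinearMap.le_opNorm _ _

lemma dotProduct_mulVec_le (M : Matrix (Fin d) (Fin d) ℝ) (x y : Fin d → ℝ) :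
    x ⬝ᵥ M *ᵥ y ≤ opNorm M * len x * len y := by
  refine (dotProduct_le_len _ _).trans ?_
  nlinarith [len_mulVec_le M y, len_nonneg x]

lemma dotProduct_mulVec_self_le (M : Matrix (Fin d) (Fin d) ℝ) (x : Fin d → ℝ) :
    x ⬝ᵥ M *ᵥ x ≤ opNorm M * (x ⬝ᵥ x) := by
  rw [← len_sq, pow_two, ← mul_assoc]; exact dotProduct_mulVec_le M x x

lemma neg_le_dotProduct_mulVec_self (M : Matrix (Fin d) (Fin d) ℝ) (x : Fin d → ℝ) :
    -(opNorm M * (x ⬝ᵥ x)) ≤ x ⬝ᵥ M *ᵥ x := by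
  have h := dotProduct_mulVec_le M (-x) x
  have h2 : len (-x) = len x := by simp [len]
  rw [h2, neg_dotProduct] at h
  rw [← len_sq]; nlinarith

lemma opNorm_le_of_len_mulVec_le {M : Matrix (Fin d) (Fin d) ℝ} {c : ℝ} (hc : 0 ≤ c)
    (h : ∀ x, len (M *ᵥ x) ≤ c * len x) : opNorm M ≤ c :=
  ContinuousLinearMap.opNorm_le_bound _ hc fun x => h x.ofLp

/-- `T` is a `1/2`-net of the unit ball, contained in the unit ball. -/
structure IsHalfNet (T : Finset (Fin d → ℝ)) : Prop where
  len_le : ∀ u ∈ T, len u ≤ 1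
  exists_near : ∀ x, len x ≤ 1 → ∃ u ∈ T, len (x - u) ≤ 1 / 2

/-- A 1-separated subset of the ball of radius 2 has at most `5 ^ d` points by volume. One of
largest cardinality is 1-dense in that ball, and halving it gives the net. -/
lemma exists_isHalfNet (d : ℕ) : ∃ T : Finset (Fin d → ℝ), IsHalfNet T ∧ T.card ≤ 5 ^ d := by
  classical
  let E := EuclideanSpace ℝ (Fin d)
  let good : Finset E → Prop := fun s =>
    (∀ c ∈ s, ‖c‖ ≤ 2) ∧ ∀ c ∈ s, ∀ e ∈ s, c ≠ e → 1 ≤ ‖c - e‖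
  have hbound : ∀ s, good s → s.card ≤ 5 ^ d := fun s hs => by
    have h := Besicovitch.card_le_of_separated s hs.1 hs.2
    rwa [show Module.finrank ℝ E = d from finrank_euclideanSpace_fin] at h
  let p : ℕ → Prop := fun k => ∃ s : Finset E, good s ∧ s.card = k
  have hp0 : p 0 := ⟨∅, ⟨by simp, by simp⟩, rfl⟩
  obtain ⟨s, hs, hcard⟩ := Nat.findGreatest_spec (P := p) (Nat.zero_le (5 ^ d)) hp0
  refine ⟨s.image fun c => ((1 / 2 : ℝ) • c).ofLp, ⟨fun u hu => ?_, fun x hx => ?_⟩,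
    Finset.card_image_le.trans (hbound s hs)⟩
  · obtain ⟨c, hc, rfl⟩ := Finset.mem_image.1 hu
    have := hs.1 c hc
    change ‖(1 / 2 : ℝ) • c‖ ≤ 1
    rw [norm_smul, Real.norm_of_nonneg (by norm_num)]
    linarith
  · let y : E := (2 : ℝ) • WithLp.toLp 2 x
    have hy : ‖y‖ ≤ 2 := by
      rw [norm_smul, Real.norm_of_nonneg (by norm_num)]
      have : ‖(WithLp.toLp 2 x : E)‖ ≤ 1 := hx
      linarith
    have hnear : ∃ c ∈ s, ‖y - c‖ ≤ 1 := by
      by_contra hcon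
      push Not at hcon
      have hys : y ∉ s := fun hmem => by
        have := hcon y hmem
        rw [sub_self, norm_zero] at this
        linarith
      have hg : good (insert y s) := by
        refine ⟨fun c hc => ?_, fun c hc e he hce => ?_⟩
        · rcases Finset.mem_insert.1 hc with rfl | hc
          · exact hy
          · exact hs.1 c hc
        · rcases Finset.mem_insert.1 hc with rfl | hc <;> rcases Finset.mem_insert.1 he with rfl | he
          · exact absurd rfl hce
          · exact (hcon e he).le
          · rw [norm_sub_rev]; exact (hcon c hc).le
          · exact hs.2 c hc e he hce
      have h1 : (insert y s).card ≤ Nat.findGreatest p (5 ^ d) :=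
        Nat.le_findGreatest (hbound _ hg) ⟨_, hg, rfl⟩
      rw [← hcard, Finset.card_insert_of_notMem hys] at h1
      omega
    obtain ⟨c, hc, hyc⟩ := hnear
    refine ⟨_, Finset.mem_image_of_mem _ hc, ?_⟩
    have : (WithLp.toLp 2 (x - ((1 / 2 : ℝ) • c).ofLp) : E) = (1 / 2 : ℝ) • (y - c) := by
      rw [smul_sub, smul_smul]
      norm_num
    rw [len, this, norm_smul, Real.norm_of_nonneg (by norm_num)]
    linarith

/-- Replacing `w / len w` by a nearby net point loses at most `len w / 2`. -/
lemma IsHalfNet.len_le_of_forall_dotProduct_le {T : Finset (Fin d → ℝ)} (hT : IsHalfNet T)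
    {w : Fin d → ℝ} {b : ℝ} (h : ∀ u ∈ T, u ⬝ᵥ w ≤ b) : len w ≤ 2 * b := by
  rcases eq_or_ne w 0 with rfl | hw
  · obtain ⟨u, hu, -⟩ := hT.exists_near 0 (by simp [len])
    have := h u hu
    rw [dotProduct_zero] at this
    rw [len_eq_zero.2 rfl]; linarith
  · have hpos : 0 < len w := lt_of_le_of_ne (len_nonneg w) fun h => hw (len_eq_zero.1 h.symm)
    obtain ⟨u, hu, hxu⟩ := hT.exists_near ((len w)⁻¹ • w) (by
      rw [len_smul, abs_of_pos (inv_pos.2 hpos), inv_mul_cancel₀ hpos.ne'])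
    have h1 : ((len w)⁻¹ • w) ⬝ᵥ w = len w := by
      rw [smul_dotProduct, ← len_sq, smul_eq_mul]; field_simp
    have h2 := dotProduct_le_len ((len w)⁻¹ • w - u) w
    rw [sub_dotProduct, h1] at h2
    nlinarith [h u hu]

/-- One factor 2 from the net for each of the two arguments of the bilinear form. -/
lemma IsHalfNet.opNorm_le {T : Finset (Fin d → ℝ)} (hT : IsHalfNet T)
    {M : Matrix (Fin d) (Fin d) ℝ} {b : ℝ} (h : ∀ u ∈ T, ∀ v ∈ T, u ⬝ᵥ M *ᵥ v ≤ b) :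
    opNorm M ≤ 4 * b := by
  have h1 : ∀ u ∈ T, len (Mᵀ *ᵥ u) ≤ 2 * b := fun u hu =>
    hT.len_le_of_forall_dotProduct_le fun v hv => by
      rw [dotProduct_comm, Matrix.mulVec_transpose, ← Matrix.dotProduct_mulVec]; exact h u hu v hv
  have hb : 0 ≤ b := by
    obtain ⟨u, hu, -⟩ := hT.exists_near 0 (by simp [len])
    linarith [h1 u hu, len_nonneg (Mᵀ *ᵥ u)]
  refine opNorm_le_of_len_mulVec_le (by positivity) fun x => ?_
  have h2 := hT.len_le_of_forall_dotProduct_le (w := M *ᵥ x) (b := 2 * b * len x) fun u hu => by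
    rw [Matrix.dotProduct_mulVec, ← Matrix.mulVec_transpose]
    exact (dotProduct_le_len _ _).trans (by gcongr; exacts [len_nonneg x, h1 u hu])
  linarith

lemma exists_lamMin_eq {M : Matrix (Fin d) (Fin d) ℝ} (hM : M.IsHermitian) (hd : 0 < d) :
    (∃ x, x ⬝ᵥ x = 1 ∧ x ⬝ᵥ M *ᵥ x = lamMin M) ∧ ∀ x, lamMin M * (x ⬝ᵥ x) ≤ x ⬝ᵥ M *ᵥ x := by
  have hne : Nonempty (Fin d) := ⟨⟨0, hd⟩⟩
  obtain ⟨i, hi⟩ := Finite.exists_min hM.eigenvalues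
  have hlam : lamMin M = hM.eigenvalues i := by
    rw [lamMin, hM.spectrum_real_eq_range_eigenvalues]
    exact IsLeast.csInf_eq ⟨⟨i, rfl⟩, by rintro _ ⟨j, rfl⟩; exact hi j⟩
  refine ⟨⟨(hM.eigenvectorBasis i).ofLp, ?_, ?_⟩, fun x => ?_⟩
  · rw [← len_sq, len]
    change ‖hM.eigenvectorBasis i‖ ^ 2 = 1
    simp
  · rw [hM.mulVec_eigenvectorBasis, dotProduct_smul, hlam, ← len_sq, len]
    change _ • ‖hM.eigenvectorBasis i‖ ^ 2 = _
    simp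
  · set y : EuclideanSpace ℝ (Fin d) := WithLp.toLp 2 x with hy
    have h1 : x ⬝ᵥ M *ᵥ x = ∑ j, hM.eigenvalues j * inner ℝ (hM.eigenvectorBasis j) y ^ 2 := by
      have h2 : (WithLp.toLp 2 (M *ᵥ x) : EuclideanSpace ℝ (Fin d)) = ∑ j,
          inner ℝ (hM.eigenvectorBasis j) y • (hM.eigenvalues j • hM.eigenvectorBasis j) := by
        change Matrix.toLpLin 2 2 M y = _
        conv_lhs => rw [← hM.eigenvectorBasis.sum_repr' y]
        rw [map_sum]
        refine Finset.sum_congr rfl fun i _ => ?_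
        rw [map_smul, Matrix.toLpLin_apply, hM.mulVec_eigenvectorBasis]
        rfl
      rw [dotProduct_eq_inner, h2, inner_sum]
      refine Finset.sum_congr rfl fun j _ => ?_
      rw [inner_smul_right, inner_smul_right, real_inner_comm y]
      ring
    have h3 : x ⬝ᵥ x = ∑ j, inner ℝ (hM.eigenvectorBasis j) y ^ 2 := by
      rw [← len_sq, len, ← hM.eigenvectorBasis.sum_sq_norm_inner_right]
      simp [hy]
    rw [h1, h3, Finset.mul_sum, hlam]
    refine Finset.sum_le_sum fun j _ => ?_
    gcongr
    exact hi j

end Nets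

/-! ### The Gramian and the discrete Lyapunov equation. -/

section Gramian

variable {d : ℕ} {A : Matrix (Fin d) (Fin d) ℝ}

attribute [local instance] Matrix.linftyOpNormedRing Matrix.linftyOpNormedAlgebra in
/-- The entries of the powers of a stable matrix decay geometrically. -/
lemma Stable.exists_abs_pow_apply_le (hA : Stable A) :
    ∃ r : ℝ, 0 ≤ r ∧ r < 1 ∧ ∀ᶠ t : ℕ in Filter.atTop, ∀ i j, |(A ^ t) i j| ≤ r ^ t := by
  set B := A.map (algebraMap ℝ ℂ) with hB
  have hBpow : ∀ t, B ^ t = (A ^ t).map (algebraMap ℝ ℂ) := fun t => by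
    rw [hB]; exact (map_pow (algebraMap ℝ ℂ).mapMatrix A t).symm
  obtain ⟨r, hr1, hr2⟩ := ENNReal.lt_iff_exists_nnreal_btwn.1 (show spectralRadius ℂ B < 1 from hA)
  refine ⟨r, r.2, by exact_mod_cast hr2, ?_⟩
  -- Gelfand's formula; any `r` strictly between the spectral radius and 1 serves.
  have ht := spectrum.pow_nnnorm_pow_one_div_tendsto_nhds_spectralRadius B
  filter_upwards [ht.eventually (gt_mem_nhds hr1), Filter.eventually_gt_atTop 0] with t h h0 i j
  have h1 : (‖B ^ t‖₊ : ℝ≥0∞) ≤ (r : ℝ≥0∞) ^ t := by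
    have h2 := ENNReal.rpow_le_rpow h.le (z := t) (by positivity)
    rwa [← ENNReal.rpow_mul, one_div, inv_mul_cancel₀ (by positivity), ENNReal.rpow_one,
      ENNReal.rpow_natCast] at h2
  have h3 : ‖B ^ t‖₊ ≤ r ^ t := by exact_mod_cast h1
  have h4 : ‖(B ^ t) i j‖₊ ≤ ‖B ^ t‖₊ := by
    rw [Matrix.linfty_opNNNorm_def]
    exact (Finset.single_le_sum (f := fun j => ‖(B ^ t) i j‖₊) (fun _ _ => zero_le)
      (Finset.mem_univ j)).trans
      (Finset.le_sup (f := fun i => ∑ j, ‖(B ^ t) i j‖₊) (Finset.mem_univ i))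
  have h5 : ‖(B ^ t) i j‖ ≤ (r : ℝ) ^ t := by exact_mod_cast h4.trans h3
  rw [hBpow] at h5
  simpa using h5

lemma Stable.summable (hA : Stable A) (M : Matrix (Fin d) (Fin d) ℝ) :
    Summable fun t : ℕ => A ^ t * M * (A ^ t)ᵀ := by
  obtain ⟨r, hr0, hr1, hr⟩ := hA.exists_abs_pow_apply_le
  refine Pi.summable.2 fun i => Pi.summable.2 fun j => ?_
  have hs : Summable fun t : ℕ => ∑ b, ∑ a, (A ^ t) i a * M a b * (A ^ t) j b := by
    refine summable_sum fun b _ => summable_sum fun a _ => ?_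
    have hgeo : Summable fun t : ℕ => |M a b| * r ^ t :=
      (summable_geometric_of_lt_one hr0 hr1).mul_left _
    refine Summable.of_norm_bounded_eventually_nat hgeo ?_
    filter_upwards [hr] with t ht
    rw [Real.norm_eq_abs, abs_mul, abs_mul]
    have h1 := ht i a
    have h2 := ht j b
    have h3 : r ^ t ≤ 1 := pow_le_one₀ hr0 hr1.le
    calc |(A ^ t) i a| * |M a b| * |(A ^ t) j b| ≤ r ^ t * |M a b| * 1 := by
          gcongr; exact h2.trans h3
      _ = _ := by ring
  refine hs.congr fun t => ?_
  simp [Matrix.mul_apply, Finset.sum_mul, -Matrix.transpose_pow]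

/-- The stationary covariance `∑ₜ Aᵗ M (Aᵗ)ᵀ` for noise with covariance `M`. -/
noncomputable def gramianOf (A M : Matrix (Fin d) (Fin d) ℝ) : Matrix (Fin d) (Fin d) ℝ :=
  ∑' t : ℕ, A ^ t * M * (A ^ t)ᵀ

lemma gramian_eq : gramian A = gramianOf A 1 := by simp [gramian, gramianOf]

/-- `N ↦ uᵀ N u` is linear and continuous, so it passes through the series. The Gramian is then
handled as a quadratic form. -/
lemma Stable.hasSum_gramianOf (hA : Stable A) (M : Matrix (Fin d) (Fin d) ℝ) (u : Fin d → ℝ) :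
    HasSum (fun t => ((Aᵀ ^ t) *ᵥ u) ⬝ᵥ M *ᵥ ((Aᵀ ^ t) *ᵥ u)) (u ⬝ᵥ gramianOf A M *ᵥ u) := by
  let φ : Matrix (Fin d) (Fin d) ℝ →ₗ[ℝ] ℝ :=
    { toFun := fun N => u ⬝ᵥ N *ᵥ u
      map_add' := fun N N' => by rw [Matrix.add_mulVec, dotProduct_add]
      map_smul' := fun c N => by rw [Matrix.smul_mulVec, dotProduct_smul]; rfl }
  have hφ : Continuous φ := by
    change Continuous fun N : Matrix (Fin d) (Fin d) ℝ => u ⬝ᵥ N *ᵥ u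
    fun_prop
  have h := (hA.summable M).hasSum.map φ hφ
  have heq : (fun t => ((Aᵀ ^ t) *ᵥ u) ⬝ᵥ M *ᵥ ((Aᵀ ^ t) *ᵥ u))
      = φ ∘ fun t => A ^ t * M * (A ^ t)ᵀ := by
    funext t
    change _ = u ⬝ᵥ (A ^ t * M * (A ^ t)ᵀ) *ᵥ u
    rw [← Matrix.mulVec_mulVec, ← Matrix.mulVec_mulVec, Matrix.dotProduct_mulVec u (A ^ t),
      ← Matrix.mulVec_transpose, Matrix.transpose_pow]
  rw [heq]
  exact h

lemma isHermitian_gramianOf {M : Matrix (Fin d) (Fin d) ℝ} (hM : M.IsHermitian) :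
    (gramianOf A M).IsHermitian := by
  have hM' : Mᵀ = M := by rwa [Matrix.IsHermitian, Matrix.conjTranspose_eq_transpose_of_trivial] at hM
  rw [Matrix.IsHermitian, Matrix.conjTranspose_eq_transpose_of_trivial, gramianOf,
    Matrix.transpose_tsum]
  congr 1
  ext1 t
  rw [Matrix.transpose_mul, Matrix.transpose_mul, Matrix.transpose_transpose, hM', mul_assoc]

lemma Stable.gramianOf_mono (hA : Stable A) {M N : Matrix (Fin d) (Fin d) ℝ}
    (h : ∀ u, u ⬝ᵥ M *ᵥ u ≤ u ⬝ᵥ N *ᵥ u) (u : Fin d → ℝ) :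
    u ⬝ᵥ gramianOf A M *ᵥ u ≤ u ⬝ᵥ gramianOf A N *ᵥ u :=
  hasSum_le (fun _ => h _) (hA.hasSum_gramianOf M u) (hA.hasSum_gramianOf N u)

/-- The Lyapunov equation, as an identity of quadratic forms. -/
lemma Stable.gramianOf_eq (hA : Stable A) (M : Matrix (Fin d) (Fin d) ℝ) (u : Fin d → ℝ) :
    u ⬝ᵥ gramianOf A M *ᵥ u = u ⬝ᵥ M *ᵥ u + (Aᵀ *ᵥ u) ⬝ᵥ gramianOf A M *ᵥ (Aᵀ *ᵥ u) := by
  have h1 := hA.hasSum_gramianOf M u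
  have h2 := hA.hasSum_gramianOf M (Aᵀ *ᵥ u)
  have h3 := (hasSum_nat_add_iff' 1).2 h1
  simp only [Finset.sum_range_one, pow_zero, Matrix.one_mulVec] at h3
  have h4 : ∀ t : ℕ, Aᵀ ^ (t + 1) *ᵥ u = Aᵀ ^ t *ᵥ (Aᵀ *ᵥ u) := fun t => by
    rw [pow_succ, Matrix.mulVec_mulVec]
  simp only [h4] at h3
  linarith [h3.unique h2]

lemma dotProduct_gramian_nonneg (hA : Stable A) (u : Fin d → ℝ) :
    0 ≤ u ⬝ᵥ gramian A *ᵥ u := by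
  rw [gramian_eq]
  refine (hA.hasSum_gramianOf 1 u).nonneg fun t => ?_
  rw [Matrix.one_mulVec, ← len_sq]; positivity

lemma dotProduct_le_gramian (hA : Stable A) (u : Fin d → ℝ) :
    u ⬝ᵥ u ≤ u ⬝ᵥ gramian A *ᵥ u := by
  have h := hA.gramianOf_eq 1 u
  have h2 := dotProduct_gramian_nonneg hA (Aᵀ *ᵥ u)
  rw [gramian_eq] at *
  rw [Matrix.one_mulVec] at h
  linarith

lemma gramian_transpose_mulVec_le (hA : Stable A) (u : Fin d → ℝ) :
    (Aᵀ *ᵥ u) ⬝ᵥ gramian A *ᵥ (Aᵀ *ᵥ u) ≤ u ⬝ᵥ gramian A *ᵥ u := by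
  have h := hA.gramianOf_eq 1 u
  have h2 : 0 ≤ u ⬝ᵥ u := by rw [← len_sq]; positivity
  rw [gramian_eq] at *
  rw [Matrix.one_mulVec] at h
  linarith

lemma sum_transpose_pow_le_gramian (hA : Stable A) (u : Fin d → ℝ) (n : ℕ) :
    ∑ t ∈ Finset.range n, ((Aᵀ ^ t) *ᵥ u) ⬝ᵥ ((Aᵀ ^ t) *ᵥ u) ≤ u ⬝ᵥ gramian A *ᵥ u := by
  have h := hA.hasSum_gramianOf 1 u
  simp only [Matrix.one_mulVec] at h
  rw [gramian_eq]
  exact sum_le_hasSum _ (fun t _ => by rw [← len_sq]; positivity) h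

lemma one_le_opNorm_gramian (hA : Stable A) (hd : 0 < d) : 1 ≤ opNorm (gramian A) := by
  let u : Fin d → ℝ := Pi.single ⟨0, hd⟩ 1
  have hu : u ⬝ᵥ u = 1 := by simp [u]
  have h1 := dotProduct_le_gramian hA u
  have h2 := dotProduct_mulVec_self_le (gramian A) u
  rw [hu] at *
  linarith

lemma Stable.tendsto_dotProduct (hA : Stable A) (u : Fin d → ℝ) :
    Filter.Tendsto (fun t : ℕ => ((Aᵀ ^ t) *ᵥ u) ⬝ᵥ ((Aᵀ ^ t) *ᵥ u)) Filter.atTop (nhds 0) := by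
  have h := (hA.hasSum_gramianOf 1 u).summable.tendsto_atTop_zero
  simpa only [Matrix.one_mulVec] using h

/-- Comparison for the discrete Lyapunov equation. -/
lemma Stable.le_gramianOf_of_le (hA : Stable A) {f m : (Fin d → ℝ) → ℝ} {b : ℝ}
    (hfm : ∀ u, f u = f (Aᵀ *ᵥ u) + m u) (hfb : ∀ u, f u ≤ b * (u ⬝ᵥ u))
    {M : Matrix (Fin d) (Fin d) ℝ} {c : ℝ} (hm : ∀ u, m u ≤ c * (u ⬝ᵥ M *ᵥ u)) (u : Fin d → ℝ) :
    f u ≤ c * (u ⬝ᵥ gramianOf A M *ᵥ u) := by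
  -- Iterating the recursion leaves `f ((Aᵀ)ᵗ u)`, whose bound tends to 0 by stability however large
  -- the fixed constant `b` is.
  have h1 : ∀ t : ℕ, f u ≤ b * (((Aᵀ ^ t) *ᵥ u) ⬝ᵥ ((Aᵀ ^ t) *ᵥ u))
      + c * ∑ s ∈ Finset.range t, ((Aᵀ ^ s) *ᵥ u) ⬝ᵥ M *ᵥ ((Aᵀ ^ s) *ᵥ u) := by
    have h2 : ∀ t : ℕ, f u ≤ f ((Aᵀ ^ t) *ᵥ u)
        + c * ∑ s ∈ Finset.range t, ((Aᵀ ^ s) *ᵥ u) ⬝ᵥ M *ᵥ ((Aᵀ ^ s) *ᵥ u) := by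
      intro t
      induction t with
      | zero => simp
      | succ t ih =>
        have h3 := hfm ((Aᵀ ^ t) *ᵥ u)
        rw [Matrix.mulVec_mulVec, ← pow_succ'] at h3
        have h4 := hm ((Aᵀ ^ t) *ᵥ u)
        rw [Finset.sum_range_succ, mul_add]
        linarith
    exact fun t => (h2 t).trans (by gcongr; exact hfb _)
  have h5 := ((hA.tendsto_dotProduct u).const_mul b).add
    ((hA.hasSum_gramianOf M u).tendsto_sum_nat.const_mul c)
  rw [mul_zero, zero_add] at h5
  exact ge_of_tendsto' h5 h1

end Gramian

/-! ### Comparing the empirical covariance with the stationary one, path by path. -/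

section Deterministic

variable {d : ℕ} (A : Matrix (Fin d) (Fin d) ℝ) (e : ℕ → Fin d → ℝ) (n : ℕ)

/-- The unnormalised empirical second moment of the covariates in the direction `u`. -/
noncomputable def energy (u : Fin d → ℝ) : ℝ :=
  ∑ t ∈ Finset.range n, (u ⬝ᵥ trajectory A e (t + 1)) ^ 2

/-- The unnormalised empirical covariance of the noise. -/
noncomputable def noiseMat : Matrix (Fin d) (Fin d) ℝ :=
  ∑ t ∈ Finset.range n, Matrix.vecMulVec (e t) (e t)

/-- The unnormalised empirical correlation between the drift and the noise. -/
noncomputable def crossMat : Matrix (Fin d) (Fin d) ℝ :=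
  ∑ t ∈ Finset.range n, Matrix.vecMulVec (A *ᵥ trajectory A e t) (e t)

/-- The unnormalised empirical correlation between the covariates and the noise. -/
noncomputable def scoreMat : Matrix (Fin d) (Fin d) ℝ :=
  ∑ t ∈ Finset.range (n + 1), Matrix.vecMulVec (trajectory A e t) (e t)

lemma dotProduct_vecMulVec_mulVec (u v a b : Fin d → ℝ) :
    u ⬝ᵥ Matrix.vecMulVec a b *ᵥ v = (u ⬝ᵥ a) * (v ⬝ᵥ b) := by
  rw [Matrix.vecMulVec_mulVec, dotProduct_comm v b]
  simp [dotProduct_smul, mul_comm]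

lemma dotProduct_sum_mulVec {ι : Type*} (s : Finset ι) (M : ι → Matrix (Fin d) (Fin d) ℝ)
    (u v : Fin d → ℝ) : u ⬝ᵥ (∑ i ∈ s, M i) *ᵥ v = ∑ i ∈ s, u ⬝ᵥ M i *ᵥ v := by
  rw [Matrix.sum_mulVec, dotProduct_sum]

lemma dotProduct_noiseMat (u v : Fin d → ℝ) :
    u ⬝ᵥ noiseMat e n *ᵥ v = ∑ t ∈ Finset.range n, (u ⬝ᵥ e t) * (v ⬝ᵥ e t) := by
  simp only [noiseMat, dotProduct_sum_mulVec, dotProduct_vecMulVec_mulVec]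

lemma dotProduct_mulVec_transpose (u v : Fin d → ℝ) : u ⬝ᵥ A *ᵥ v = (Aᵀ *ᵥ u) ⬝ᵥ v := by
  rw [Matrix.dotProduct_mulVec, Matrix.mulVec_transpose]

lemma dotProduct_crossMat (u v : Fin d → ℝ) :
    u ⬝ᵥ crossMat A e n *ᵥ v
      = ∑ t ∈ Finset.range n, ((Aᵀ *ᵥ u) ⬝ᵥ trajectory A e t) * (v ⬝ᵥ e t) := by
  simp only [crossMat, dotProduct_sum_mulVec, dotProduct_vecMulVec_mulVec]
  simp only [dotProduct_mulVec_transpose]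

lemma dotProduct_scoreMat (u v : Fin d → ℝ) :
    u ⬝ᵥ scoreMat A e n *ᵥ v
      = ∑ t ∈ Finset.range (n + 1), (u ⬝ᵥ trajectory A e t) * (v ⬝ᵥ e t) := by
  simp only [scoreMat, dotProduct_sum_mulVec, dotProduct_vecMulVec_mulVec]

lemma sum_range_succ_eq_energy (u : Fin d → ℝ) :
    ∑ t ∈ Finset.range (n + 1), (u ⬝ᵥ trajectory A e t) ^ 2 = energy A e n u := by
  rw [Finset.sum_range_succ', energy]
  simp [trajectory]

lemma energy_nonneg (u : Fin d → ℝ) : 0 ≤ energy A e n u :=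
  Finset.sum_nonneg fun _ _ => sq_nonneg _

lemma sum_range_le_energy (u : Fin d → ℝ) :
    ∑ t ∈ Finset.range n, (u ⬝ᵥ trajectory A e t) ^ 2 ≤ energy A e n u := by
  rw [← sum_range_succ_eq_energy, Finset.sum_range_succ]
  linarith [sq_nonneg (u ⬝ᵥ trajectory A e n)]

/-- Expand the square of `uᵀ x_{t+1} = (Aᵀ u)ᵀ x_t + uᵀ e_t`. Shifting the time index costs only the
boundary term at time `n`, because `x_0 = 0`. This is a Lyapunov equation for the empirical
covariance. -/
lemma energy_eq (u : Fin d → ℝ) :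
    energy A e n u = energy A e n (Aᵀ *ᵥ u)
      + (u ⬝ᵥ noiseMat e n *ᵥ u + 2 * (u ⬝ᵥ crossMat A e n *ᵥ u)
        - ((Aᵀ *ᵥ u) ⬝ᵥ trajectory A e n) ^ 2) := by
  rw [← sum_range_succ_eq_energy A e n (Aᵀ *ᵥ u), Finset.sum_range_succ, dotProduct_noiseMat,
    dotProduct_crossMat, Finset.mul_sum, energy]
  have h : ∀ t, (u ⬝ᵥ trajectory A e (t + 1)) ^ 2 = ((Aᵀ *ᵥ u) ⬝ᵥ trajectory A e t) ^ 2
      + (u ⬝ᵥ e t * u ⬝ᵥ e t + 2 * ((Aᵀ *ᵥ u) ⬝ᵥ trajectory A e t * u ⬝ᵥ e t)) := fun t => by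
    rw [trajectory, dotProduct_add, dotProduct_mulVec_transpose]; ring
  simp only [h, Finset.sum_add_distrib]
  ring

/-- Deliberately crude: some constant is needed only so that the remainder in
`Stable.le_gramianOf_of_le` vanishes. -/
lemma energy_le (u : Fin d → ℝ) :
    energy A e n u ≤ (∑ t ∈ Finset.range n, len (trajectory A e (t + 1)) ^ 2) * (u ⬝ᵥ u) := by
  rw [energy, Finset.sum_mul]
  refine Finset.sum_le_sum fun t _ => ?_
  rw [← len_sq, ← mul_pow, ← sq_abs]
  refine pow_le_pow_left₀ (abs_nonneg _) ?_ 2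
  rw [mul_comm, dotProduct_eq_inner]
  exact abs_real_inner_le_norm _ _

variable {A e n}

/-- The correlation between drift and noise is small, by a bootstrap argument. -/
lemma opNorm_crossMat_le (hA : Stable A) (hd : 0 < d) {T : Finset (Fin d → ℝ)} (hT : IsHalfNet T)
    {Q : Matrix (Fin d) (Fin d) ℝ} {s τ : ℝ} (hs : 1 / 2 ≤ s)
    (hQ : ∀ u, u ⬝ᵥ Q *ᵥ u ≤ 2 * s * (u ⬝ᵥ u))
    (hN : opNorm (noiseMat e n - (n : ℝ) • Q) ≤ n / 8)
    (hn : 2 ^ 23 * (s ^ 2 * opNorm (gramian A) * τ) ≤ n)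
    (hK : ∀ u ∈ T, ∀ v ∈ T, u ⬝ᵥ crossMat A e n *ᵥ v ≤ 128 * (s ^ 2 * opNorm (gramian A) * τ)
      + (∑ t ∈ Finset.range n, ((Aᵀ *ᵥ u) ⬝ᵥ trajectory A e t) ^ 2)
        / (256 * s * opNorm (gramian A))) :
    opNorm (crossMat A e n) ≤ n / 8 := by
  set G := opNorm (gramian A) with hG
  set κ := opNorm (crossMat A e n) with hκ
  have hG1 : 1 ≤ G := one_le_opNorm_gramian hA hd
  have hκ0 : 0 ≤ κ := opNorm_nonneg _
  have hn0 : (0 : ℝ) ≤ n := n.cast_nonneg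
  -- An a priori bound on the energy in terms of the unknown `κ`. The coefficient is `2s + 1/8 ≤
  -- 9s/4`, since `s ≥ 1/2`.
  have hup : ∀ u, energy A e n u ≤ (9 / 4 * s * n + 2 * κ) * (u ⬝ᵥ gramian A *ᵥ u) := by
    rw [gramian_eq]
    refine hA.le_gramianOf_of_le (energy_eq A e n) (energy_le A e n) fun u => ?_
    rw [Matrix.one_mulVec]
    have h1 := dotProduct_mulVec_self_le (noiseMat e n - (n : ℝ) • Q) u
    rw [Matrix.sub_mulVec, dotProduct_sub, Matrix.smul_mulVec, dotProduct_smul, smul_eq_mul] at h1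
    have h2 := dotProduct_mulVec_self_le (crossMat A e n) u
    have h3 : 0 ≤ u ⬝ᵥ u := by rw [← len_sq]; positivity
    have h4 := hQ u
    have h5 : opNorm (noiseMat e n - (n : ℝ) • Q) * (u ⬝ᵥ u) ≤ n / 8 * (u ⬝ᵥ u) := by gcongr
    have h6 : (n : ℝ) * (u ⬝ᵥ Q *ᵥ u) ≤ n * (2 * s * (u ⬝ᵥ u)) := by gcongr
    have h7 : n / 8 * (u ⬝ᵥ u) ≤ s / 4 * (n * (u ⬝ᵥ u)) := by
      nlinarith [mul_nonneg hn0 h3]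
    nlinarith [sq_nonneg ((Aᵀ *ᵥ u) ⬝ᵥ trajectory A e n)]
  have hb : ∀ u ∈ T, ∀ v ∈ T, u ⬝ᵥ crossMat A e n *ᵥ v
      ≤ 128 * (s ^ 2 * G * τ) + (9 / 4 * s * n + 2 * κ) / (256 * s) := by
    intro u hu v hv
    refine (hK u hu v hv).trans ?_
    have h1 := (sum_range_le_energy A e n (Aᵀ *ᵥ u)).trans (hup (Aᵀ *ᵥ u))
    have h2 := (gramian_transpose_mulVec_le hA u).trans (dotProduct_mulVec_self_le (gramian A) u)
    have h3 : u ⬝ᵥ u ≤ 1 := by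
      rw [← len_sq]; exact pow_le_one₀ (len_nonneg u) (hT.len_le u hu)
    have h4 : (Aᵀ *ᵥ u) ⬝ᵥ gramian A *ᵥ (Aᵀ *ᵥ u) ≤ G :=
      h2.trans (mul_le_of_le_one_right (by positivity) h3)
    have h5 : ∑ t ∈ Finset.range n, ((Aᵀ *ᵥ u) ⬝ᵥ trajectory A e t) ^ 2
        ≤ (9 / 4 * s * n + 2 * κ) * G := h1.trans (by gcongr)
    gcongr 128 * (s ^ 2 * G * τ) + ?_
    rw [div_le_div_iff₀ (by positivity) (by positivity)]
    nlinarith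
  -- The bootstrap closes: `κ ≤ 4 (n / 2^16 + 9 n / 1024 + κ / 64)`, and `κ / 16` is absorbed on the
  -- left.
  have h := hT.opNorm_le hb
  rw [← hκ] at h
  have h6 : (9 / 4 * s * n + 2 * κ) / (256 * s) ≤ 9 / 1024 * n + κ / 64 := by
    rw [div_le_iff₀ (by positivity)]
    nlinarith
  linarith

/-- The empirical covariance is comparable to the stationary one. -/
lemma energy_bounds (hA : Stable A) {Q : Matrix (Fin d) (Fin d) ℝ}
    (hQ : ∀ u, u ⬝ᵥ u ≤ u ⬝ᵥ Q *ᵥ u)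
    (hN : opNorm (noiseMat e n - (n : ℝ) • Q) ≤ n / 8)
    (hK : opNorm (crossMat A e n) ≤ n / 8)
    (hx : len (A *ᵥ trajectory A e n) ^ 2 ≤ n / 8) (u : Fin d → ℝ) :
    n / 2 * (u ⬝ᵥ gramianOf A Q *ᵥ u) ≤ energy A e n u ∧
      energy A e n u ≤ 3 / 2 * n * (u ⬝ᵥ gramianOf A Q *ᵥ u) := by
  have hn0 : (0 : ℝ) ≤ n := n.cast_nonneg
  have hdev : ∀ u, |u ⬝ᵥ noiseMat e n *ᵥ u - n * (u ⬝ᵥ Q *ᵥ u)| ≤ n / 8 * (u ⬝ᵥ u) ∧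
      |u ⬝ᵥ crossMat A e n *ᵥ u| ≤ n / 8 * (u ⬝ᵥ u) ∧ 0 ≤ u ⬝ᵥ u := fun u => by
    have h3 : 0 ≤ u ⬝ᵥ u := by rw [← len_sq]; positivity
    have key : ∀ M : Matrix (Fin d) (Fin d) ℝ, opNorm M ≤ n / 8 →
        |u ⬝ᵥ M *ᵥ u| ≤ n / 8 * (u ⬝ᵥ u) := fun M hM => by
      have h1 := dotProduct_mulVec_self_le M u
      have h2 := neg_le_dotProduct_mulVec_self M u
      rw [abs_le]; constructor <;> nlinarith
    have h1 := key _ hN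
    rw [Matrix.sub_mulVec, dotProduct_sub, Matrix.smul_mulVec, dotProduct_smul, smul_eq_mul] at h1
    exact ⟨h1, key _ hK, h3⟩
  constructor
  · have h := hA.le_gramianOf_of_le (f := fun u => -energy A e n u) (b := 0)
      (m := fun u => -(u ⬝ᵥ noiseMat e n *ᵥ u + 2 * (u ⬝ᵥ crossMat A e n *ᵥ u)
        - ((Aᵀ *ᵥ u) ⬝ᵥ trajectory A e n) ^ 2)) (c := -(n / 2)) (M := Q)
      (fun u => by rw [energy_eq]; ring) (fun u => by linarith [energy_nonneg A e n u])
      (fun u => ?_) u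
    · linarith
    · obtain ⟨h1, h2, h3⟩ := hdev u
      have h4 : ((Aᵀ *ᵥ u) ⬝ᵥ trajectory A e n) ^ 2 ≤ n / 8 * (u ⬝ᵥ u) := by
        rw [← dotProduct_mulVec_transpose, ← sq_abs]
        have : |u ⬝ᵥ A *ᵥ trajectory A e n| ≤ len u * len (A *ᵥ trajectory A e n) := by
          rw [dotProduct_eq_inner]; exact abs_real_inner_le_norm _ _
        calc |u ⬝ᵥ A *ᵥ trajectory A e n| ^ 2
            ≤ (len u * len (A *ᵥ trajectory A e n)) ^ 2 := by gcongr
          _ = len (A *ᵥ trajectory A e n) ^ 2 * (u ⬝ᵥ u) := by rw [mul_pow, len_sq u]; ring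
          _ ≤ _ := by gcongr
      have h5 := mul_le_mul_of_nonneg_left (hQ u) hn0
      have h6 := (abs_le.1 h1).1
      have h7 := (abs_le.1 h2).1
      linarith
  · refine hA.le_gramianOf_of_le (energy_eq A e n) (energy_le A e n) (fun u => ?_) u
    obtain ⟨h1, h2, h3⟩ := hdev u
    have h5 := mul_le_mul_of_nonneg_left (hQ u) hn0
    have h6 := (abs_le.1 h1).2
    have h7 := (abs_le.1 h2).2
    linarith [sq_nonneg ((Aᵀ *ᵥ u) ⬝ᵥ trajectory A e n), mul_nonneg hn0 h3]

end Deterministic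

/-! ### From the score to the least squares error. -/

section LeastSquares

variable {d n : ℕ} {A : Matrix (Fin d) (Fin d) ℝ} {e : ℕ → Fin d → ℝ}

lemma dotProduct_transpose_mul_mulVec {m : ℕ} (Y X : Matrix (Fin m) (Fin d) ℝ) (u v : Fin d → ℝ) :
    u ⬝ᵥ (Yᵀ * X) *ᵥ v = ∑ i, (u ⬝ᵥ Y i) * (v ⬝ᵥ X i) := by
  rw [← Matrix.mulVec_mulVec, Matrix.dotProduct_mulVec, Matrix.vecMul_transpose]
  simp only [dotProduct, Matrix.mulVec]
  refine Finset.sum_congr rfl fun i _ => ?_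
  simp only [mul_comm (u _), mul_comm (v _)]

lemma dotProduct_covariates (x : ℕ → Fin d → ℝ) (u v : Fin d → ℝ) :
    u ⬝ᵥ ((covariates n x)ᵀ * covariates n x) *ᵥ v
      = ∑ t ∈ Finset.range n, (u ⬝ᵥ x (t + 1)) * (v ⬝ᵥ x (t + 1)) := by
  rw [dotProduct_transpose_mul_mulVec,
    ← Fin.sum_univ_eq_sum_range fun t => (u ⬝ᵥ x (t + 1)) * (v ⬝ᵥ x (t + 1))]
  rfl

lemma dotProduct_covariates_self (u : Fin d → ℝ) :
    u ⬝ᵥ ((covariates n (trajectory A e))ᵀ * covariates n (trajectory A e)) *ᵥ u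
      = energy A e n u := by
  simp only [dotProduct_covariates, energy, pow_two]

/-- Substitute the dynamics into the responses. The score may be indexed from time 0, with `n + 1`
terms, because its first term vanishes with `x_0`. -/
lemma dotProduct_responses (u v : Fin d → ℝ) :
    u ⬝ᵥ ((responses n (trajectory A e))ᵀ * covariates n (trajectory A e)) *ᵥ v
      = (Aᵀ *ᵥ u) ⬝ᵥ ((covariates n (trajectory A e))ᵀ * covariates n (trajectory A e)) *ᵥ v
        + v ⬝ᵥ scoreMat A e n *ᵥ u := by
  rw [dotProduct_covariates, dotProduct_scoreMat, dotProduct_transpose_mul_mulVec,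
    Finset.sum_range_succ', ← Fin.sum_univ_eq_sum_range, ← Fin.sum_univ_eq_sum_range fun t =>
      (v ⬝ᵥ trajectory A e (t + 1)) * (u ⬝ᵥ e (t + 1))]
  simp only [trajectory, dotProduct_zero, zero_mul, add_zero, ← Finset.sum_add_distrib]
  refine Finset.sum_congr rfl fun i _ => ?_
  change (u ⬝ᵥ trajectory A e (i + 2)) * (v ⬝ᵥ trajectory A e (i + 1)) = _
  rw [← dotProduct_mulVec_transpose]
  simp only [trajectory, dotProduct_add]
  ring

lemma dotProduct_leastSquares_sub
    (hX : IsUnit ((covariates n (trajectory A e))ᵀ * covariates n (trajectory A e)))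
    (u z : Fin d → ℝ) :
    u ⬝ᵥ (leastSquares (covariates n (trajectory A e)) (responses n (trajectory A e)) - A) *ᵥ z
      = (((covariates n (trajectory A e))ᵀ * covariates n (trajectory A e))⁻¹ *ᵥ z) ⬝ᵥ
          scoreMat A e n *ᵥ u := by
  rw [Matrix.sub_mulVec, dotProduct_sub, leastSquares, ← Matrix.mulVec_mulVec,
    dotProduct_responses, Matrix.mulVec_mulVec,
    Matrix.mul_nonsing_inv _ ((Matrix.isUnit_iff_isUnit_det _).1 hX), Matrix.one_mulVec,
    dotProduct_mulVec_transpose A]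
  ring

lemma isHermitian_empCov (X : Matrix (Fin n) (Fin d) ℝ) : (empCov X).IsHermitian := by
  rw [Matrix.IsHermitian, Matrix.conjTranspose_eq_transpose_of_trivial, empCov,
    Matrix.transpose_smul, Matrix.transpose_mul, Matrix.transpose_transpose]

lemma dotProduct_empCov (u : Fin d → ℝ) :
    u ⬝ᵥ empCov (covariates n (trajectory A e)) *ᵥ u = (n : ℝ)⁻¹ * energy A e n u := by
  rw [empCov, Matrix.smul_mulVec, dotProduct_smul, dotProduct_covariates_self, smul_eq_mul]

lemma isUnit_covariates (h : ∀ u, u ≠ 0 → 0 < energy A e n u) :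
    IsUnit ((covariates n (trajectory A e))ᵀ * covariates n (trajectory A e)) := by
  refine Matrix.PosDef.isUnit (.of_dotProduct_mulVec_pos ?_ fun u hu => ?_)
  · rw [Matrix.IsHermitian, Matrix.conjTranspose_eq_transpose_of_trivial,
      Matrix.transpose_mul, Matrix.transpose_transpose]
  · rw [star_trivial, dotProduct_covariates_self]
    exact h u hu

open scoped MatrixOrder Matrix.Norms.L2Operator in
lemma exists_eq_transpose_mul_self {M : Matrix (Fin d) (Fin d) ℝ} (hM : M.PosSemidef) :
    ∃ R : Matrix (Fin d) (Fin d) ℝ, M = Rᵀ * R := by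
  obtain ⟨R, hR⟩ := CStarAlgebra.nonneg_iff_eq_star_mul_self.mp hM.nonneg
  exact ⟨R, by rw [hR, Matrix.star_eq_conjTranspose,
    Matrix.conjTranspose_eq_transpose_of_trivial]⟩

/-- A linear change of coordinates that turns a positive definite form into the Euclidean one. -/
lemma exists_whitening {M : Matrix (Fin d) (Fin d) ℝ} (hM : M.IsHermitian)
    (h : ∀ u, u ⬝ᵥ u ≤ u ⬝ᵥ M *ᵥ u) :
    ∃ B R : Matrix (Fin d) (Fin d) ℝ, B * R = 1 ∧ (∀ w, (B *ᵥ w) ⬝ᵥ M *ᵥ (B *ᵥ w) = w ⬝ᵥ w) ∧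
      ∀ p, len (R *ᵥ p) ^ 2 = p ⬝ᵥ M *ᵥ p := by
  have hpos : M.PosDef := .of_dotProduct_mulVec_pos hM fun u hu => by
    rw [star_trivial]
    refine lt_of_lt_of_le ?_ (h u)
    rw [← len_sq]
    exact pow_pos (lt_of_le_of_ne (len_nonneg u) fun h => hu (len_eq_zero.1 h.symm)) 2
  obtain ⟨R, hR⟩ := exists_eq_transpose_mul_self hpos.posSemidef
  have hRu : IsUnit R.det := by
    have := (Matrix.isUnit_iff_isUnit_det _).1 hpos.isUnit
    rw [hR, Matrix.det_mul] at this
    exact isUnit_of_mul_isUnit_right this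
  have hlen : ∀ p, len (R *ᵥ p) ^ 2 = p ⬝ᵥ M *ᵥ p := fun p => by
    rw [len_sq, hR, ← Matrix.mulVec_mulVec, Matrix.dotProduct_mulVec p, Matrix.vecMul_transpose]
  refine ⟨R⁻¹, R, Matrix.nonsing_inv_mul _ hRu, fun w => ?_, hlen⟩
  rw [← hlen, Matrix.mulVec_mulVec, Matrix.mul_nonsing_inv _ hRu, Matrix.one_mulVec, len_sq]

/-- Operator norm error of least squares from a self-normalised bound on the score. -/
lemma len_leastSquares_sub_le {M : Matrix (Fin d) (Fin d) ℝ} (hd : 0 < d) (hn : 0 < n)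
    (hX : IsUnit ((covariates n (trajectory A e))ᵀ * covariates n (trajectory A e)))
    (hM : ∀ p, n / 2 * (p ⬝ᵥ M *ᵥ p) ≤ energy A e n p)
    (hlam : 0 < lamMin (empCov (covariates n (trajectory A e)))) {c : ℝ} (hc : 0 ≤ c)
    (hscore : ∀ p u, p ⬝ᵥ scoreMat A e n *ᵥ u ≤ c * √(p ⬝ᵥ M *ᵥ p) * len u) (z : Fin d → ℝ) :
    len ((leastSquares (covariates n (trajectory A e)) (responses n (trajectory A e)) - A) *ᵥ z)
      ≤ c * √(2 / n * (1 / (n * lamMin (empCov (covariates n (trajectory A e)))))) * len z := by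
  set Λ := lamMin (empCov (covariates n (trajectory A e))) with hΛ
  have hn' : (0 : ℝ) < n := by exact_mod_cast hn
  refine len_le_of_forall_dotProduct_le (mul_nonneg (by positivity) (len_nonneg z)) fun u => ?_
  rw [dotProduct_leastSquares_sub hX]
  set p := ((covariates n (trajectory A e))ᵀ * covariates n (trajectory A e))⁻¹ *ᵥ z with hp
  refine (hscore p u).trans ?_
  have hS : energy A e n p ≤ len p * len z := by
    rw [← dotProduct_covariates_self]
    have : ((covariates n (trajectory A e))ᵀ * covariates n (trajectory A e)) *ᵥ p = z := by
      rw [hp, Matrix.mulVec_mulVec,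
        Matrix.mul_nonsing_inv _ ((Matrix.isUnit_iff_isUnit_det _).1 hX), Matrix.one_mulVec]
    rw [this]
    exact dotProduct_le_len p z
  have hlow : n * Λ * len p ^ 2 ≤ energy A e n p := by
    have h := (exists_lamMin_eq (isHermitian_empCov (covariates n (trajectory A e))) hd).2 p
    rw [dotProduct_empCov, ← len_sq, ← hΛ, inv_mul_eq_div, le_div_iff₀ hn'] at h
    linarith
  have hS0 := energy_nonneg A e n p
  -- Combine `energy p ≤ |p| |z|` with `n Λ |p|² ≤ energy p` and cancel one factor of the energy.
  have hS2 : n * Λ * energy A e n p ≤ len z ^ 2 := by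
    rcases hS0.eq_or_lt with h0 | h0
    · rw [← h0, mul_zero]; positivity
    · refine le_of_mul_le_mul_left ?_ h0
      calc energy A e n p * (n * Λ * energy A e n p) = n * Λ * energy A e n p ^ 2 := by ring
        _ ≤ n * Λ * (len p * len z) ^ 2 := by gcongr
        _ = n * Λ * len p ^ 2 * len z ^ 2 := by ring
        _ ≤ energy A e n p * len z ^ 2 := by gcongr
  have hsq : √(p ⬝ᵥ M *ᵥ p) ≤ √(2 / n * (1 / (n * Λ))) * len z := by
    refine Real.sqrt_le_iff.2 ⟨mul_nonneg (Real.sqrt_nonneg _) (len_nonneg z), ?_⟩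
    rw [mul_pow, Real.sq_sqrt (by positivity)]
    have h1 : p ⬝ᵥ M *ᵥ p ≤ 2 / n * energy A e n p := by
      rw [div_mul_eq_mul_div, le_div_iff₀ hn']
      linarith [hM p]
    have h2 : energy A e n p ≤ 1 / (n * Λ) * len z ^ 2 := by
      rw [one_div, inv_mul_eq_div, le_div_iff₀ (by positivity)]
      linarith
    calc p ⬝ᵥ M *ᵥ p ≤ 2 / n * (1 / (n * Λ) * len z ^ 2) := h1.trans (by gcongr)
      _ = _ := by ring
  have := len_nonneg u
  calc c * √(p ⬝ᵥ M *ᵥ p) * len u ≤ c * (√(2 / n * (1 / (n * Λ))) * len z) * len u := by gcongr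
    _ = _ := by ring

end LeastSquares

/-! ### The test supermartingales and their deterministic consequences. -/

section GoodEvent

variable {d : ℕ}

/-- The log-increments of the exponential supermartingale of a linear statistic of the noise. -/
noncomputable def linFun (s : ℝ) (c : ℕ → (Fin d → ℝ) → Fin d → ℝ) :
    ℕ → (Fin d → ℝ) → (Fin d → ℝ) → ℝ :=
  fun t x y => c t x ⬝ᵥ y - s / 2 * (c t x ⬝ᵥ c t x)

/-- The log-increments of the exponential supermartingale of a quadratic statistic of the noise
with covariance `Q`. -/
noncomputable def sqFun (Q : Matrix (Fin d) (Fin d) ℝ) (s l : ℝ) (w : Fin d → ℝ) :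
    ℕ → (Fin d → ℝ) → (Fin d → ℝ) → ℝ :=
  fun _ _ y => l * ((w ⬝ᵥ y) ^ 2 - w ⬝ᵥ Q *ᵥ w) - 512 * (s * l) ^ 2

/-- Unrolling the recursion makes the terminal state a linear statistic of the noise with
deterministic coefficients, so it too is controlled by a `linFun`. -/
lemma dotProduct_trajectory (A : Matrix (Fin d) (Fin d) ℝ) (e : ℕ → Fin d → ℝ) (n : ℕ)
    (w : Fin d → ℝ) :
    w ⬝ᵥ trajectory A e n = ∑ t ∈ Finset.range n, (Aᵀ ^ (n - 1 - t) *ᵥ w) ⬝ᵥ e t := by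
  induction n generalizing w with
  | zero => simp [trajectory]
  | succ n ih =>
    rw [trajectory, dotProduct_add, dotProduct_mulVec_transpose, ih, Finset.sum_range_succ]
    simp only [Nat.add_sub_cancel, Nat.sub_self, pow_zero, Matrix.one_mulVec]
    congr 1
    refine Finset.sum_congr rfl fun t ht => ?_
    have : t < n := Finset.mem_range.1 ht
    rw [Matrix.mulVec_mulVec, ← pow_succ, show n - 1 - t + 1 = n - t by omega]

variable (A B Q : Matrix (Fin d) (Fin d) ℝ) (n : ℕ) (s τ : ℝ) (T : Finset (Fin d → ℝ))

open Classical in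
/-- The supermartingales whose control yields the estimation bound, with their horizons. -/
noncomputable def testFunctions : Finset (ℕ × (ℕ → (Fin d → ℝ) → (Fin d → ℝ) → ℝ)) :=
  -- In order: noise covariance (two families, for polarisation), cross term, terminal state, score.
  -- The halves keep the test vectors in the unit ball. The cross-term scale makes its compensator
  -- small enough for the bootstrap; the two square-root scales balance `τ` against the expected
  -- compensator up to constants.
  (T ×ˢ T).image (fun p => (n, sqFun Q s (1 / (65536 * s ^ 2)) ((1 / 2 : ℝ) • (p.1 + p.2)))) ∪
  (T ×ˢ T).image (fun p => (n, sqFun Q s (-(1 / (65536 * s ^ 2))) ((1 / 2 : ℝ) • (p.1 - p.2)))) ∪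
  (T ×ˢ T).image (fun p => (n, linFun s fun _ x =>
    (1 / (128 * s ^ 2 * opNorm (gramian A)) * ((Aᵀ *ᵥ p.1) ⬝ᵥ x)) • p.2)) ∪
  (T ×ˢ T).image (fun p => (n, linFun s fun t _ =>
    √(τ / (s * opNorm (gramian A))) • (Aᵀ ^ (n - 1 - t) *ᵥ (Aᵀ *ᵥ p.1)))) ∪
  (T ×ˢ T).image (fun p => (n + 1, linFun s fun _ x =>
    (√(τ / (n * s)) * ((B *ᵥ p.1) ⬝ᵥ x)) • p.2))

lemma card_testFunctions_le :
    (testFunctions A B Q n s τ T).card ≤ 5 * (T.card * T.card) := by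
  classical
  have h : ∀ f : (Fin d → ℝ) × (Fin d → ℝ) → ℕ × (ℕ → (Fin d → ℝ) → (Fin d → ℝ) → ℝ),
      ((T ×ˢ T).image f).card ≤ T.card * T.card := fun f =>
    Finset.card_image_le.trans_eq (Finset.card_product T T)
  unfold testFunctions
  refine (Finset.card_union_le _ _).trans ?_
  refine (Nat.add_le_add_right (Finset.card_union_le _ _) _).trans ?_
  refine (Nat.add_le_add_right (Nat.add_le_add_right (Finset.card_union_le _ _) _) _).trans ?_
  refine (Nat.add_le_add_right (Nat.add_le_add_right (Nat.add_le_add_right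
    (Finset.card_union_le _ _) _) _) _).trans ?_
  have h5 : 5 * (T.card * T.card) = T.card * T.card + T.card * T.card + T.card * T.card
    + T.card * T.card + T.card * T.card := by ring
  rw [h5]
  gcongr <;> exact h _

variable {A B Q n s τ T} {e : ℕ → Fin d → ℝ}

lemma sum_linFun_scaled (N : ℕ) (a : ℝ) (w v : Fin d → ℝ) :
    ∑ t ∈ Finset.range N, linFun s (fun _ x => (a * (w ⬝ᵥ x)) • v) t (trajectory A e t) (e t)
      = a * ∑ t ∈ Finset.range N, (w ⬝ᵥ trajectory A e t) * (v ⬝ᵥ e t)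
        - s / 2 * a ^ 2 * (v ⬝ᵥ v) * ∑ t ∈ Finset.range N, (w ⬝ᵥ trajectory A e t) ^ 2 := by
  rw [Finset.mul_sum, Finset.mul_sum, ← Finset.sum_sub_distrib]
  refine Finset.sum_congr rfl fun t _ => ?_
  simp only [linFun, smul_dotProduct, dotProduct_smul, smul_eq_mul]
  ring

lemma sum_sqFun (l : ℝ) (w : Fin d → ℝ) :
    ∑ t ∈ Finset.range n, sqFun Q s l w t (trajectory A e t) (e t)
      = l * (w ⬝ᵥ (noiseMat e n - (n : ℝ) • Q) *ᵥ w) - n * (512 * (s * l) ^ 2) := by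
  rw [Matrix.sub_mulVec, dotProduct_sub, Matrix.smul_mulVec, dotProduct_smul, smul_eq_mul,
    dotProduct_noiseMat]
  simp only [sqFun, Finset.sum_sub_distrib, ← Finset.mul_sum, Finset.sum_const, Finset.card_range,
    nsmul_eq_mul, pow_two]
  ring

lemma dotProduct_self_le_one (hT : IsHalfNet T) {v : Fin d → ℝ} (hv : v ∈ T) : v ⬝ᵥ v ≤ 1 := by
  rw [← len_sq]; exact pow_le_one₀ (len_nonneg v) (hT.len_le v hv)

/-- Divide the supermartingale bound by `a`; the compensator is the energy in the direction `w`,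
because `v ⬝ᵥ v ≤ 1` on the net. -/
lemma sum_mul_le_of_linFun_lt (hT : IsHalfNet T) (hs : 0 < s) {N : ℕ} {a : ℝ} (ha : 0 < a)
    {w v : Fin d → ℝ} (hv : v ∈ T)
    (h : ∑ t ∈ Finset.range N, linFun s (fun _ x => (a * (w ⬝ᵥ x)) • v) t (trajectory A e t) (e t)
      < τ) :
    ∑ t ∈ Finset.range N, (w ⬝ᵥ trajectory A e t) * (v ⬝ᵥ e t)
      ≤ τ / a + s / 2 * a * ∑ t ∈ Finset.range N, (w ⬝ᵥ trajectory A e t) ^ 2 := by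
  rw [sum_linFun_scaled] at h
  set S := ∑ t ∈ Finset.range N, (w ⬝ᵥ trajectory A e t) ^ 2
  have hS : 0 ≤ S := Finset.sum_nonneg fun _ _ => sq_nonneg _
  have h1 : s / 2 * a ^ 2 * (v ⬝ᵥ v) * S ≤ s / 2 * a ^ 2 * 1 * S := by
    gcongr; exact dotProduct_self_le_one hT hv
  have h2 : τ / a + s / 2 * a * S = (τ + s / 2 * a ^ 2 * S) / a := by field_simp
  rw [h2, le_div_iff₀ ha]
  linarith

/-- By symmetry, polarisation reduces bilinear entries to one-sided bounds on two quadratic forms.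
Each is at most `n/128` from `τ` plus `n/128` from the compensator, and the net multiplies the total
`n/32` by 4. -/
lemma opNorm_noiseMat_sub_le (hA : Stable A) (hd : 0 < d) (hT : IsHalfNet T) (hs : 1 / 2 ≤ s)
    (hQ : Qᵀ = Q) (hτ : 0 < τ) (hn : 2 ^ 23 * (s ^ 2 * opNorm (gramian A) * τ) ≤ n)
    (he : ∀ f ∈ testFunctions A B Q n s τ T,
      ∑ t ∈ Finset.range f.1, f.2 t (trajectory A e t) (e t) < τ) :
    opNorm (noiseMat e n - (n : ℝ) • Q) ≤ n / 8 := by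
  set M := noiseMat e n - (n : ℝ) • Q with hM
  have hMt : Mᵀ = M := by
    rw [hM, Matrix.transpose_sub, Matrix.transpose_smul, hQ, noiseMat, Matrix.transpose_sum]
    simp only [Matrix.transpose_vecMulVec]
  have hn8 : (n : ℝ) / 8 = 4 * (n / 32) := by ring
  rw [hn8]
  refine hT.opNorm_le fun u hu v hv => ?_
  have hG := one_le_opNorm_gramian hA hd
  have hs2 : 0 < s ^ 2 := by positivity
  have hsn : 65536 * s ^ 2 * τ ≤ n / 128 := by
    have : s ^ 2 * τ * 1 ≤ s ^ 2 * τ * opNorm (gramian A) := by gcongr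
    linarith
  have key : 512 * (s * (1 / (65536 * s ^ 2))) ^ 2 * (65536 * s ^ 2) = 1 / 128 := by
    field_simp; norm_num
  have h1 : ((1 / 2 : ℝ) • (u + v)) ⬝ᵥ M *ᵥ ((1 / 2 : ℝ) • (u + v)) ≤ n / 64 := by
    have h := he (n, sqFun Q s (1 / (65536 * s ^ 2)) ((1 / 2 : ℝ) • (u + v))) (by
      simp only [testFunctions, Finset.mem_union, Finset.mem_image]
      exact Or.inl (Or.inl (Or.inl (Or.inl ⟨(u, v), Finset.mk_mem_product hu hv, rfl⟩))))
    simp only at h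
    rw [sum_sqFun, one_div_mul_eq_div, ← hM, sub_lt_iff_lt_add, div_lt_iff₀ (by positivity)] at h
    nlinarith
  have h2 : -(((1 / 2 : ℝ) • (u - v)) ⬝ᵥ M *ᵥ ((1 / 2 : ℝ) • (u - v))) ≤ n / 64 := by
    have h := he (n, sqFun Q s (-(1 / (65536 * s ^ 2))) ((1 / 2 : ℝ) • (u - v))) (by
      simp only [testFunctions, Finset.mem_union, Finset.mem_image]
      exact Or.inl (Or.inl (Or.inl (Or.inr ⟨(u, v), Finset.mk_mem_product hu hv, rfl⟩))))
    simp only at h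
    rw [sum_sqFun, mul_neg, neg_sq, neg_mul, one_div_mul_eq_div, ← neg_div, ← hM,
      sub_lt_iff_lt_add, div_lt_iff₀ (by positivity)] at h
    nlinarith
  have h3 : u ⬝ᵥ M *ᵥ v = ((1 / 2 : ℝ) • (u + v)) ⬝ᵥ M *ᵥ ((1 / 2 : ℝ) • (u + v))
      - ((1 / 2 : ℝ) • (u - v)) ⬝ᵥ M *ᵥ ((1 / 2 : ℝ) • (u - v)) := by
    have h4 : v ⬝ᵥ M *ᵥ u = u ⬝ᵥ M *ᵥ v := by
      rw [dotProduct_mulVec_transpose, hMt, dotProduct_comm]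
    simp only [Matrix.mulVec_smul, Matrix.mulVec_add, Matrix.mulVec_sub, smul_dotProduct,
      dotProduct_smul, add_dotProduct, sub_dotProduct, dotProduct_add, dotProduct_sub, smul_eq_mul,
      h4]
    ring
  rw [h3]
  linarith

/-- This is the boundary term of `energy_eq`. The squared coefficients of its linear form sum to at
most `G`, giving a bound `9 s G τ`. -/
lemma len_mulVec_trajectory_sq_le (hA : Stable A) (hd : 0 < d) (hT : IsHalfNet T) (hs : 1 / 2 ≤ s)
    (hτ : 0 < τ) (hn : 2 ^ 23 * (s ^ 2 * opNorm (gramian A) * τ) ≤ n)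
    (he : ∀ f ∈ testFunctions A B Q n s τ T,
      ∑ t ∈ Finset.range f.1, f.2 t (trajectory A e t) (e t) < τ) :
    len (A *ᵥ trajectory A e n) ^ 2 ≤ n / 8 := by
  set G := opNorm (gramian A) with hGdef
  have hG : 1 ≤ G := one_le_opNorm_gramian hA hd
  have hs0 : 0 < s := by linarith
  set l := √(τ / (s * G)) with hl
  have hl0 : 0 < l := Real.sqrt_pos.2 (by positivity)
  have hl2 : l ^ 2 = τ / (s * G) := Real.sq_sqrt (by positivity)
  have hlen : len (A *ᵥ trajectory A e n) ≤ 2 * (3 / 2 * (τ / l)) := by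
    refine hT.len_le_of_forall_dotProduct_le fun u hu => ?_
    have h := he (n, linFun s fun t _ => l • (Aᵀ ^ (n - 1 - t) *ᵥ (Aᵀ *ᵥ u))) (by
      simp only [testFunctions, Finset.mem_union, Finset.mem_image]
      exact Or.inl (Or.inr ⟨(u, u), Finset.mk_mem_product hu hu, rfl⟩))
    simp only [linFun, smul_dotProduct, dotProduct_smul, smul_eq_mul, Finset.sum_sub_distrib,
      ← Finset.mul_sum] at h
    rw [← dotProduct_trajectory, ← dotProduct_mulVec_transpose,
      Finset.sum_range_reflect fun t => (Aᵀ ^ t *ᵥ (Aᵀ *ᵥ u)) ⬝ᵥ (Aᵀ ^ t *ᵥ (Aᵀ *ᵥ u))] at h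
    have h1 : ∑ t ∈ Finset.range n, (Aᵀ ^ t *ᵥ (Aᵀ *ᵥ u)) ⬝ᵥ (Aᵀ ^ t *ᵥ (Aᵀ *ᵥ u)) ≤ G :=
      (sum_transpose_pow_le_gramian hA (Aᵀ *ᵥ u) n).trans <|
        (gramian_transpose_mulVec_le hA u).trans <| (dotProduct_mulVec_self_le _ u).trans <|
          mul_le_of_le_one_right (by positivity) (dotProduct_self_le_one hT hu)
    have h2 : s / 2 * (l * (l * ∑ t ∈ Finset.range n,
        (Aᵀ ^ t *ᵥ (Aᵀ *ᵥ u)) ⬝ᵥ (Aᵀ ^ t *ᵥ (Aᵀ *ᵥ u)))) ≤ s / 2 * (l * (l * G)) := by gcongr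
    have h3 : s / 2 * (l * (l * G)) = τ / 2 := by
      rw [← mul_assoc l l, ← pow_two, hl2]; field_simp
    rw [← mul_div_assoc, le_div_iff₀ hl0]
    linarith
  calc len (A *ᵥ trajectory A e n) ^ 2 ≤ (2 * (3 / 2 * (τ / l))) ^ 2 := by
        gcongr; exact len_nonneg _
    _ = 9 * (s * G * τ) := by
        rw [show (2 * (3 / 2 * (τ / l))) ^ 2 = 9 * (τ ^ 2 / l ^ 2) by ring, hl2]
        field_simp
    _ ≤ n / 8 := by
      have : 1 / 2 * (s * G * τ) ≤ s * (s * G * τ) := by gcongr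
      nlinarith

/-- On the event where all test supermartingales are controlled, the empirical covariance is
comparable to the stationary one. -/
lemma energy_bounds_of_testFunctions (hA : Stable A) (hd : 0 < d) (hT : IsHalfNet T)
    (hs : 1 / 2 ≤ s) (hQ : Qᵀ = Q) (hQ1 : ∀ u, u ⬝ᵥ u ≤ u ⬝ᵥ Q *ᵥ u)
    (hQ2 : ∀ u, u ⬝ᵥ Q *ᵥ u ≤ 2 * s * (u ⬝ᵥ u)) (hτ : 0 < τ)
    (hn : 2 ^ 23 * (s ^ 2 * opNorm (gramian A) * τ) ≤ n)
    (he : ∀ f ∈ testFunctions A B Q n s τ T,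
      ∑ t ∈ Finset.range f.1, f.2 t (trajectory A e t) (e t) < τ) (u : Fin d → ℝ) :
    n / 2 * (u ⬝ᵥ gramianOf A Q *ᵥ u) ≤ energy A e n u ∧
      energy A e n u ≤ 3 / 2 * n * (u ⬝ᵥ gramianOf A Q *ᵥ u) := by
  have hN := opNorm_noiseMat_sub_le hA hd hT hs hQ hτ hn he
  have hG := one_le_opNorm_gramian hA hd
  have hs0 : 0 < s := by linarith
  refine energy_bounds hA hQ1 hN (opNorm_crossMat_le hA hd hT hs hQ2 hN hn fun u hu v hv => ?_)
    (len_mulVec_trajectory_sq_le hA hd hT hs hτ hn he) u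
  have h := he (n, linFun s fun _ x =>
      (1 / (128 * s ^ 2 * opNorm (gramian A)) * ((Aᵀ *ᵥ u) ⬝ᵥ x)) • v) (by
    simp only [testFunctions, Finset.mem_union, Finset.mem_image]
    exact Or.inl (Or.inl (Or.inr ⟨(u, v), Finset.mk_mem_product hu hv, rfl⟩)))
  rw [dotProduct_crossMat]
  refine (sum_mul_le_of_linFun_lt hT hs0 (by positivity) hv h).trans_eq ?_
  field_simp
  ring

/-- On the event where all test supermartingales are controlled, the score is self-normalised. -/
lemma score_le_of_testFunctions {R : Matrix (Fin d) (Fin d) ℝ} (hT : IsHalfNet T)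
    (hs : 0 < s) (hτ : 0 < τ) (hn : 0 < n) (hBR : B * R = 1)
    (hB : ∀ w, (B *ᵥ w) ⬝ᵥ gramianOf A Q *ᵥ (B *ᵥ w) = w ⬝ᵥ w)
    (hR : ∀ p, len (R *ᵥ p) ^ 2 = p ⬝ᵥ gramianOf A Q *ᵥ p)
    (hen : ∀ u, energy A e n u ≤ 3 / 2 * n * (u ⬝ᵥ gramianOf A Q *ᵥ u))
    (he : ∀ f ∈ testFunctions A B Q n s τ T,
      ∑ t ∈ Finset.range f.1, f.2 t (trajectory A e t) (e t) < τ) (p u : Fin d → ℝ) :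
    p ⬝ᵥ scoreMat A e n *ᵥ u ≤ 7 * √(τ * n * s) * √(p ⬝ᵥ gramianOf A Q *ᵥ p) * len u := by
  have hn' : (0 : ℝ) < n := by exact_mod_cast hn
  set l := √(τ / (n * s)) with hl
  have hl0 : 0 < l := Real.sqrt_pos.2 (by positivity)
  have hl2 : l ^ 2 = τ / (n * s) := Real.sq_sqrt (by positivity)
  have hr : √(τ * n * s) = n * s * l := by
    rw [Real.sqrt_eq_iff_mul_self_eq (by positivity) (by positivity)]
    symm
    calc n * s * l * (n * s * l) = (n * s) ^ 2 * l ^ 2 := by ring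
      _ = _ := by rw [hl2]; field_simp
  -- After whitening, every net direction has energy at most `3n/2`, so one fixed scale `l`
  -- suffices. The coefficient is `1 + (1/2)(3/2) = 7/4`.
  have hop : opNorm (Bᵀ * scoreMat A e n) ≤ 4 * (7 / 4 * √(τ * n * s)) := by
    refine hT.opNorm_le fun w hw v hv => ?_
    rw [← Matrix.mulVec_mulVec, Matrix.dotProduct_mulVec, Matrix.vecMul_transpose,
      dotProduct_scoreMat]
    have h := he (n + 1, linFun s fun _ x => (l * ((B *ᵥ w) ⬝ᵥ x)) • v) (by
      simp only [testFunctions, Finset.mem_union, Finset.mem_image]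
      exact Or.inr ⟨(w, v), Finset.mk_mem_product hw hv, rfl⟩)
    refine (sum_mul_le_of_linFun_lt hT hs hl0 hv h).trans ?_
    rw [sum_range_succ_eq_energy]
    have h1 : energy A e n (B *ᵥ w) ≤ 3 / 2 * n := by
      refine (hen _).trans ?_
      rw [hB]
      exact mul_le_of_le_one_right (by positivity) (dotProduct_self_le_one hT hw)
    have h2 : τ / l = n * s * l := by
      rw [div_eq_iff hl0.ne']
      calc τ = n * s * l ^ 2 := by rw [hl2]; field_simp
        _ = _ := by ring
    rw [h2, hr]
    have h3 : s / 2 * l * energy A e n (B *ᵥ w) ≤ s / 2 * l * (3 / 2 * n) := by gcongr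
    linarith
  have hp : p ⬝ᵥ scoreMat A e n *ᵥ u = (R *ᵥ p) ⬝ᵥ (Bᵀ * scoreMat A e n) *ᵥ u := by
    rw [← Matrix.mulVec_mulVec, Matrix.dotProduct_mulVec (R *ᵥ p), Matrix.vecMul_transpose,
      Matrix.mulVec_mulVec, hBR, Matrix.one_mulVec]
  rw [hp, ← hR, Real.sqrt_sq (len_nonneg _)]
  refine (dotProduct_mulVec_le _ _ _).trans ?_
  have := len_nonneg (R *ᵥ p)
  have := len_nonneg u
  gcongr
  linarith

end GoodEvent

/-! ### Probabilistic properties of the noise and the good event. -/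

section Noise

variable {d : ℕ} {Ω : Type*} [MeasurableSpace Ω] {P : Measure Ω} [IsProbabilityMeasure P]
  {η : ℕ → Ω → Fin d → ℝ} {σ : ℝ≥0}

lemma measurable_dotProduct_left (hm : ∀ t, Measurable (η t)) (t : ℕ) (u : Fin d → ℝ) :
    Measurable fun ω => u ⬝ᵥ η t ω := by
  have := hm t
  unfold dotProduct
  fun_prop

lemma subgaussian_dotProduct
    (hsub : ∀ t, ∀ u : Fin d → ℝ, u ⬝ᵥ u = 1 → HasSubgaussianMGF (fun ω => u ⬝ᵥ η t ω) (σ ^ 2) P)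
    (t : ℕ) (u : Fin d → ℝ) :
    HasSubgaussianMGF (fun ω => u ⬝ᵥ η t ω) (⟨len u ^ 2, sq_nonneg _⟩ * σ ^ 2) P := by
  rcases eq_or_ne u 0 with rfl | hu
  · exact ⟨fun t => by simp, fun t => by simpa [mgf] using by positivity⟩
  · have hpos : 0 < len u := lt_of_le_of_ne (len_nonneg u) fun h => hu (len_eq_zero.1 h.symm)
    have h1 : ((len u)⁻¹ • u) ⬝ᵥ ((len u)⁻¹ • u) = 1 := by
      rw [← len_sq, len_smul, abs_of_pos (inv_pos.2 hpos), inv_mul_cancel₀ hpos.ne', one_pow]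
    have h2 := (hsub t _ h1).const_mul (len u)
    refine h2.congr (ae_of_all _ fun ω => ?_)
    simp only [smul_dotProduct, smul_eq_mul]
    field_simp

lemma subgaussian_dotProduct_of_len_le
    (hsub : ∀ t, ∀ u : Fin d → ℝ, u ⬝ᵥ u = 1 → HasSubgaussianMGF (fun ω => u ⬝ᵥ η t ω) (σ ^ 2) P)
    (t : ℕ) {u : Fin d → ℝ} (hu : len u ≤ 1) :
    HasSubgaussianMGF (fun ω => u ⬝ᵥ η t ω) (σ ^ 2) P := by
  have h := subgaussian_dotProduct hsub t u
  refine ⟨h.integrable_exp_mul, fun l => (h.mgf_le l).trans (Real.exp_le_exp.2 ?_)⟩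
  have h1 : len u ^ 2 ≤ 1 := pow_le_one₀ (len_nonneg u) hu
  push_cast
  have : len u ^ 2 * (σ : ℝ) ^ 2 ≤ 1 * (σ : ℝ) ^ 2 := by gcongr
  change len u ^ 2 * (σ : ℝ) ^ 2 * l ^ 2 / 2 ≤ (σ : ℝ) ^ 2 * l ^ 2 / 2
  rw [one_mul] at this
  gcongr

/-- The second moment matrix of the noise. -/
noncomputable def noiseCov (P : Measure Ω) (η : ℕ → Ω → Fin d → ℝ) : Matrix (Fin d) (Fin d) ℝ :=
  Matrix.of fun i j => ∫ ω, η 0 ω i * η 0 ω j ∂P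

lemma transpose_noiseCov : (noiseCov P η)ᵀ = noiseCov P η := by
  ext i j
  simp only [noiseCov, Matrix.transpose_apply, Matrix.of_apply, mul_comm]

lemma memLp_noise
    (hsub : ∀ t, ∀ u : Fin d → ℝ, u ⬝ᵥ u = 1 → HasSubgaussianMGF (fun ω => u ⬝ᵥ η t ω) (σ ^ 2) P)
    (i : Fin d) : MemLp (fun ω => η 0 ω i) 2 P := by
  have h := (hsub 0 (Pi.single i 1) (by simp)).memLp 2
  simpa using h

lemma dotProduct_noiseCov (hid : ∀ t, IdentDistrib (η t) (η 0) P P)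
    (hsub : ∀ t, ∀ u : Fin d → ℝ, u ⬝ᵥ u = 1 → HasSubgaussianMGF (fun ω => u ⬝ᵥ η t ω) (σ ^ 2) P)
    (t : ℕ) (u : Fin d → ℝ) : u ⬝ᵥ noiseCov P η *ᵥ u = ∫ ω, (u ⬝ᵥ η t ω) ^ 2 ∂P := by
  have hφ : Measurable fun y : Fin d → ℝ => (u ⬝ᵥ y) ^ 2 := by unfold dotProduct; fun_prop
  have h1 : ∫ ω, (u ⬝ᵥ η t ω) ^ 2 ∂P = ∫ ω, (u ⬝ᵥ η 0 ω) ^ 2 ∂P := ((hid t).comp hφ).integral_eq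
  have h2 : ∀ ω, (u ⬝ᵥ η 0 ω) ^ 2 = ∑ i, ∑ j, u i * u j * (η 0 ω i * η 0 ω j) := fun ω => by
    rw [pow_two, dotProduct, Finset.sum_mul_sum]
    exact Finset.sum_congr rfl fun i _ => Finset.sum_congr rfl fun j _ => by ring
  have hint : ∀ i j, Integrable (fun ω => u i * u j * (η 0 ω i * η 0 ω j)) P := fun i j =>
    ((memLp_noise hsub i).integrable_mul (memLp_noise hsub j)).const_mul _
  rw [h1]
  simp_rw [h2]
  rw [integral_finsetSum _ fun i _ => integrable_finsetSum _ fun j _ => hint i j]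
  simp_rw [integral_finsetSum _ fun j _ => hint _ j, integral_const_mul]
  simp only [dotProduct, Matrix.mulVec, noiseCov, Matrix.of_apply, Finset.mul_sum]
  exact Finset.sum_congr rfl fun i _ => Finset.sum_congr rfl fun j _ => by ring

/-- In a unit direction the second moment is at least 1 and at most `2σ²`. This is what lets
absolute constants be absorbed into powers of `σ²`. -/
lemma half_le_sq_of_subgaussian (hd : 0 < d) (hm : ∀ t, Measurable (η t))
    (hsub : ∀ t, ∀ u : Fin d → ℝ, u ⬝ᵥ u = 1 → HasSubgaussianMGF (fun ω => u ⬝ᵥ η t ω) (σ ^ 2) P)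
    (hvar : ∀ t, ∀ u : Fin d → ℝ, u ⬝ᵥ u = 1 → 1 ≤ ∫ ω, (u ⬝ᵥ η t ω) ^ 2 ∂P) :
    1 / 2 ≤ (σ : ℝ) ^ 2 := by
  set u : Fin d → ℝ := Pi.single ⟨0, hd⟩ 1
  have hu : u ⬝ᵥ u = 1 := by simp [u]
  have h1 := hvar 0 u hu
  have hs := hsub 0 u hu
  rcases eq_or_ne σ 0 with h0 | h0
  · rw [h0, zero_pow two_ne_zero] at hs
    have hz : ∫ ω, (u ⬝ᵥ η 0 ω) ^ 2 ∂P = 0 := by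
      refine integral_eq_zero_of_ae ?_
      filter_upwards [hs.ae_eq_zero_of_hasSubgaussianMGF_zero] with ω hω
      simp only [Pi.zero_apply] at hω ⊢
      rw [hω]; ring
    linarith
  · have h2 := integral_sq_le_of_subgaussian (measurable_dotProduct_left hm 0 u)
      (pow_pos (pos_iff_ne_zero.2 h0) 2) hs
    push_cast at h2
    linarith

lemma noiseCov_bounds (hd : 0 < d) (hm : ∀ t, Measurable (η t))
    (hid : ∀ t, IdentDistrib (η t) (η 0) P P)
    (hsub : ∀ t, ∀ u : Fin d → ℝ, u ⬝ᵥ u = 1 → HasSubgaussianMGF (fun ω => u ⬝ᵥ η t ω) (σ ^ 2) P)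
    (hvar : ∀ t, ∀ u : Fin d → ℝ, u ⬝ᵥ u = 1 → 1 ≤ ∫ ω, (u ⬝ᵥ η t ω) ^ 2 ∂P) (u : Fin d → ℝ) :
    u ⬝ᵥ u ≤ u ⬝ᵥ noiseCov P η *ᵥ u ∧
      u ⬝ᵥ noiseCov P η *ᵥ u ≤ 2 * (σ : ℝ) ^ 2 * (u ⬝ᵥ u) := by
  have hσ := half_le_sq_of_subgaussian hd hm hsub hvar
  have hσ' : 0 < σ ^ 2 := by
    have : (0 : ℝ) < (σ : ℝ) ^ 2 := by linarith
    exact_mod_cast this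
  rcases eq_or_ne u 0 with rfl | hu
  · simp
  · have hpos : 0 < len u := lt_of_le_of_ne (len_nonneg u) fun h => hu (len_eq_zero.1 h.symm)
    have h1 : ((len u)⁻¹ • u) ⬝ᵥ ((len u)⁻¹ • u) = 1 := by
      rw [← len_sq, len_smul, abs_of_pos (inv_pos.2 hpos), inv_mul_cancel₀ hpos.ne', one_pow]
    have h2 := hvar 0 _ h1
    have h3 := integral_sq_le_of_subgaussian (measurable_dotProduct_left hm 0 _) hσ' (hsub 0 _ h1)
    rw [← dotProduct_noiseCov hid hsub 0] at h2 h3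
    have h4 : u ⬝ᵥ noiseCov P η *ᵥ u = (u ⬝ᵥ u) *
        (((len u)⁻¹ • u) ⬝ᵥ noiseCov P η *ᵥ ((len u)⁻¹ • u)) := by
      rw [← len_sq, Matrix.mulVec_smul, dotProduct_smul, smul_dotProduct, smul_eq_mul, smul_eq_mul]
      field_simp
    have h5 : 0 < u ⬝ᵥ u := by rw [← len_sq]; positivity
    push_cast at h3
    rw [h4]
    constructor <;> nlinarith

lemma lintegral_exp_linFun_le_one
    (hsub : ∀ t, ∀ u : Fin d → ℝ, u ⬝ᵥ u = 1 → HasSubgaussianMGF (fun ω => u ⬝ᵥ η t ω) (σ ^ 2) P)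
    (c : ℕ → (Fin d → ℝ) → Fin d → ℝ) (t : ℕ) (x : Fin d → ℝ) :
    ∫⁻ ω, ENNReal.ofReal (Real.exp (linFun ((σ : ℝ) ^ 2) c t x (η t ω))) ∂P ≤ 1 := by
  have h := lintegral_exp_sub_le_one_of_subgaussian (subgaussian_dotProduct hsub t (c t x)) 1
  refine le_trans (le_of_eq (lintegral_congr fun ω => ?_)) h
  congr 2
  rw [linFun, ← len_sq]
  change _ = 1 * _ - len (c t x) ^ 2 * (σ : ℝ) ^ 2 * 1 ^ 2 / 2
  ring

lemma lintegral_exp_sqFun_le_one (hm : ∀ t, Measurable (η t))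
    (hid : ∀ t, IdentDistrib (η t) (η 0) P P)
    (hsub : ∀ t, ∀ u : Fin d → ℝ, u ⬝ᵥ u = 1 → HasSubgaussianMGF (fun ω => u ⬝ᵥ η t ω) (σ ^ 2) P)
    (hσ : 1 / 2 ≤ (σ : ℝ) ^ 2) {l : ℝ} (hl : |l| = 1 / (65536 * ((σ : ℝ) ^ 2) ^ 2))
    {w : Fin d → ℝ} (hw : len w ≤ 1) (t : ℕ) (x : Fin d → ℝ) :
    ∫⁻ ω, ENNReal.ofReal (Real.exp (sqFun (noiseCov P η) ((σ : ℝ) ^ 2) l w t x (η t ω))) ∂P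
      ≤ 1 := by
  have hσ0 : (0 : ℝ) < (σ : ℝ) ^ 2 := by linarith
  have hσ' : 0 < σ ^ 2 := by exact_mod_cast hσ0
  have h := lintegral_exp_centred_sq_le_one (measurable_dotProduct_left hm t w) hσ'
    (subgaussian_dotProduct_of_len_le hsub t hw) (l := l) (by
      rw [hl]; push_cast
      refine one_div_le_one_div_of_le (by positivity) ?_
      nlinarith)
  rw [← dotProduct_noiseCov hid hsub t w] at h
  push_cast at h
  exact h

lemma measurable_linFun {s : ℝ} {c : ℕ → (Fin d → ℝ) → Fin d → ℝ} (hc : ∀ t, Measurable (c t))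
    (t : ℕ) : Measurable (Function.uncurry (linFun s c t)) := by
  have := hc t
  unfold linFun Function.uncurry dotProduct
  fun_prop

lemma measurable_sqFun {Q : Matrix (Fin d) (Fin d) ℝ} {s l : ℝ} {w : Fin d → ℝ} (t : ℕ) :
    Measurable (Function.uncurry (sqFun Q s l w t)) := by
  unfold sqFun Function.uncurry dotProduct
  fun_prop

/-- With probability at least `1 - δ`, all test supermartingales are controlled. -/
theorem exists_goodEvent (hd : 0 < d) (A B : Matrix (Fin d) (Fin d) ℝ) {δ : ℝ} (hδ : 0 < δ)
    (hδ1 : δ < 1) (hm : ∀ t, Measurable (η t)) (hi : iIndepFun η P)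
    (hid : ∀ t, IdentDistrib (η t) (η 0) P P)
    (hsub : ∀ t, ∀ u : Fin d → ℝ, u ⬝ᵥ u = 1 → HasSubgaussianMGF (fun ω => u ⬝ᵥ η t ω) (σ ^ 2) P)
    (hσ : 1 / 2 ≤ (σ : ℝ) ^ 2) {T : Finset (Fin d → ℝ)} (hT : IsHalfNet T) (hcard : T.card ≤ 5 ^ d)
    (n : ℕ) {τ : ℝ} (hτ : τ = 6 * (d + Real.log (1 / δ))) :
    ∃ G : Set Ω, MeasurableSet G ∧ ENNReal.ofReal (1 - δ) ≤ P G ∧ ∀ ω ∈ G,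
      ∀ f ∈ testFunctions A B (noiseCov P η) n ((σ : ℝ) ^ 2) τ T,
        ∑ t ∈ Finset.range f.1, f.2 t (trajectory A (fun s => η s ω) t) (η t ω) < τ := by
  have hhalf : ∀ u ∈ T, ∀ v ∈ T, len ((1 / 2 : ℝ) • (u + v)) ≤ 1 ∧
      len ((1 / 2 : ℝ) • (u - v)) ≤ 1 := fun u hu v hv => by
    have h1 := hT.len_le u hu
    have h2 := hT.len_le v hv
    have h3 : len (-v) = len v := by simp [len]
    rw [len_smul, len_smul, abs_of_pos (by norm_num)]
    have h4 := len_add_le u v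
    have h5 := len_add_le u (-v)
    rw [← sub_eq_add_neg, h3] at h5
    constructor <;> linarith
  have hl : |1 / (65536 * ((σ : ℝ) ^ 2) ^ 2)| = 1 / (65536 * ((σ : ℝ) ^ 2) ^ 2) :=
    abs_of_nonneg (by positivity)
  refine exists_measurableSet_forall_sum_adapted_lt hm hi (measurable_trajectory A η) _
    (fun f hf => ?_) (fun f hf => ?_) τ δ hδ.le ?_
  · simp only [testFunctions, Finset.mem_union, Finset.mem_image] at hf
    rcases hf with (((⟨p, hp, rfl⟩ | ⟨p, hp, rfl⟩) | ⟨p, hp, rfl⟩) | ⟨p, hp, rfl⟩) | ⟨p, hp, rfl⟩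
    · exact measurable_sqFun
    · exact measurable_sqFun
    · refine measurable_linFun fun t => ?_
      unfold dotProduct; fun_prop
    · exact measurable_linFun fun t => measurable_const
    · refine measurable_linFun fun t => ?_
      unfold dotProduct; fun_prop
  · simp only [testFunctions, Finset.mem_union, Finset.mem_image] at hf
    rcases hf with (((⟨p, hp, rfl⟩ | ⟨p, hp, rfl⟩) | ⟨p, hp, rfl⟩) | ⟨p, hp, rfl⟩) | ⟨p, hp, rfl⟩
    · have hp := Finset.mem_product.1 hp
      exact lintegral_exp_sqFun_le_one hm hid hsub hσ hl (hhalf _ hp.1 _ hp.2).1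
    · have hp := Finset.mem_product.1 hp
      exact lintegral_exp_sqFun_le_one hm hid hsub hσ (by rw [abs_neg, hl]) (hhalf _ hp.1 _ hp.2).2
    all_goals exact lintegral_exp_linFun_le_one hsub _
  · have h1 : ((testFunctions A B (noiseCov P η) n ((σ : ℝ) ^ 2) τ T).card : ℝ)
        ≤ 5 * (5 ^ d * 5 ^ d) := by
      have h := (card_testFunctions_le A B (noiseCov P η) n ((σ : ℝ) ^ 2) τ T).trans
        (Nat.mul_le_mul_left 5 (Nat.mul_le_mul hcard hcard))
      exact_mod_cast h
    have hL : 0 ≤ Real.log (1 / δ) := Real.log_nonneg (by rw [le_div_iff₀ hδ]; linarith)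
    have h2 : Real.exp (-τ) ≤ Real.exp (-6) ^ d * δ := by
      have h3 : δ = Real.exp (-Real.log (1 / δ)) := by
        rw [one_div, Real.log_inv, neg_neg, Real.exp_log hδ]
      conv_rhs => rw [h3]
      rw [← Real.exp_nat_mul, ← Real.exp_add, hτ]
      exact Real.exp_le_exp.2 (by linarith)
    have h4 : Real.exp (-6) ≤ 1 / 125 := by
      rw [Real.exp_neg, ← one_div]
      refine one_div_le_one_div_of_le (by norm_num) ?_
      have h5 : Real.exp 6 = Real.exp 1 ^ 6 := by rw [← Real.exp_nat_mul]; norm_num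
      have h6 : (2.7 : ℝ) ≤ Real.exp 1 := by linarith [Real.exp_one_gt_d9]
      rw [h5]
      calc (125 : ℝ) ≤ 2.7 ^ 6 := by norm_num
        _ ≤ _ := by gcongr
    -- The factor 6 in `τ` is chosen to beat five families of `25 ^ d` tests: `e⁻⁶ ≤ 1/125`, and `5
    -- · 5⁻ᵈ ≤ 1` because `d ≥ 1`.
    have h7 : (5 : ℝ) * (5 ^ d * 5 ^ d) * (1 / 125) ^ d ≤ 1 := by
      have : (5 : ℝ) * (5 ^ d * 5 ^ d) * (1 / 125) ^ d = 5 * (1 / 5) ^ d := by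
        rw [mul_assoc, ← mul_pow, ← mul_pow]; norm_num
      rw [this]
      calc (5 : ℝ) * (1 / 5) ^ d ≤ 5 * (1 / 5) ^ 1 := by
            gcongr 5 * ?_
            exact pow_le_pow_of_le_one (by norm_num) (by norm_num) hd
        _ = 1 := by norm_num
    calc _ ≤ 5 * (5 ^ d * 5 ^ d) * (Real.exp (-6) ^ d * δ) := by gcongr
      _ ≤ 5 * (5 ^ d * 5 ^ d) * ((1 / 125) ^ d * δ) := by gcongr
      _ = 5 * (5 ^ d * 5 ^ d) * (1 / 125) ^ d * δ := by ring
      _ ≤ 1 * δ := by gcongr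
      _ = δ := one_mul δ

end Noise

/-! ### Assembly of the bound. -/

lemma one_le_lamMin_gramian {d : ℕ} {A : Matrix (Fin d) (Fin d) ℝ} (hA : Stable A) (hd : 0 < d) :
    1 ≤ lamMin (gramian A) ∧ lamMin (gramian A) ≤ opNorm (gramian A) := by
  have hherm : (gramian A).IsHermitian := by
    rw [gramian_eq]; exact isHermitian_gramianOf Matrix.isHermitian_one
  obtain ⟨⟨u, hu, h⟩, -⟩ := exists_lamMin_eq hherm hd
  rw [← h]
  have h1 := dotProduct_le_gramian hA u
  have h2 := dotProduct_mulVec_self_le (gramian A) u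
  rw [hu] at h1 h2
  exact ⟨h1, by linarith⟩

/-- The estimation bound on the event where all test supermartingales are controlled. -/
theorem tlse_bound_of_testFunctions {d n : ℕ} {A Q B R : Matrix (Fin d) (Fin d) ℝ}
    {T : Finset (Fin d → ℝ)} {e : ℕ → Fin d → ℝ} {σ δ κ : ℝ} (hA : Stable A) (hd : 0 < d)
    (hn0 : 0 < n) (hT : IsHalfNet T) (hσ0 : 0 ≤ σ) (hσ : 1 / 2 ≤ σ ^ 2) (hQ : Qᵀ = Q)
    (hQ1 : ∀ u, u ⬝ᵥ u ≤ u ⬝ᵥ Q *ᵥ u) (hQ2 : ∀ u, u ⬝ᵥ Q *ᵥ u ≤ 2 * σ ^ 2 * (u ⬝ᵥ u))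
    (hD : 0 < (d : ℝ) + Real.log (1 / δ)) (hκ : 50 ≤ κ)
    (hn : 2 ^ 23 * ((σ ^ 2) ^ 2 * opNorm (gramian A) * (6 * (d + Real.log (1 / δ)))) ≤ n)
    (hBR : B * R = 1) (hB : ∀ w, (B *ᵥ w) ⬝ᵥ gramianOf A Q *ᵥ (B *ᵥ w) = w ⬝ᵥ w)
    (hR : ∀ p, len (R *ᵥ p) ^ 2 = p ⬝ᵥ gramianOf A Q *ᵥ p)
    (he : ∀ f ∈ testFunctions A B Q n (σ ^ 2) (6 * (d + Real.log (1 / δ))) T,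
      ∑ t ∈ Finset.range f.1, f.2 t (trajectory A e t) (e t) < 6 * (d + Real.log (1 / δ))) :
    IsUnit ((covariates n (trajectory A e))ᵀ * covariates n (trajectory A e)) ∧
      ∀ k, frobSq (tlse κ σ δ n (trajectory A e) - A) ≤ 20 * κ ^ 2 * tradeOff A σ δ n k := by
  set D := (d : ℝ) + Real.log (1 / δ) with hDdef
  have hn' : (0 : ℝ) < n := by exact_mod_cast hn0
  have hen := energy_bounds_of_testFunctions hA hd hT hσ hQ hQ1 hQ2 (by positivity) hn he
  have hgram : ∀ u, u ⬝ᵥ gramian A *ᵥ u ≤ u ⬝ᵥ gramianOf A Q *ᵥ u := by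
    rw [gramian_eq]
    exact hA.gramianOf_mono fun u => by rw [Matrix.one_mulVec]; exact hQ1 u
  have hlow : ∀ u, n / 2 * (u ⬝ᵥ gramian A *ᵥ u) ≤ energy A e n u := fun u =>
    le_trans (by gcongr; exact hgram u) (hen u).1
  have hX := isUnit_covariates (A := A) (e := e) (n := n) fun u hu => by
    refine lt_of_lt_of_le ?_ (hlow u)
    refine mul_pos (by positivity) (lt_of_lt_of_le ?_ (dotProduct_le_gramian hA u))
    rw [← len_sq]
    exact pow_pos (lt_of_le_of_ne (len_nonneg u) fun h => hu (len_eq_zero.1 h.symm)) 2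
  refine ⟨hX, fun k => ?_⟩
  set X := covariates n (trajectory A e) with hXdef
  set Y := responses n (trajectory A e)
  set Λ := lamMin (empCov X) with hΛ
  have hlamΓ := one_le_lamMin_gramian hA hd
  -- Test the lower energy bound on a minimal eigenvector of the empirical covariance; this replaces
  -- the random eigenvalue in the threshold by that of the Gramian.
  have hΛle : lamMin (gramian A) ≤ 2 * Λ := by
    obtain ⟨⟨v, hv, hvΛ⟩, -⟩ := exists_lamMin_eq (isHermitian_empCov X) hd
    have hherm : (gramian A).IsHermitian := by
      rw [gramian_eq]; exact isHermitian_gramianOf Matrix.isHermitian_one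
    have h1 := (exists_lamMin_eq hherm hd).2 v
    rw [hv, mul_one] at h1
    rw [hXdef, dotProduct_empCov, ← hXdef, ← hΛ] at hvΛ
    rw [← hvΛ, ← mul_assoc, mul_comm 2, mul_assoc, inv_mul_eq_div, le_div_iff₀ hn']
    nlinarith [hlow v]
  have hΛ0 : 0 < Λ := by linarith
  have hscore := score_le_of_testFunctions hT (by linarith) (by positivity) hn0 hBR hB hR
    (fun u => (hen u).2) he
  set ξ := threshold κ σ δ X
  have hξ : ξ = κ * σ * √(D / (n * Λ)) := rfl
  have hξ0 : 0 ≤ ξ := by rw [hξ]; positivity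
  have hop : ∀ x, ‖Matrix.toLpLin 2 2 (leastSquares X Y - A) x‖ ≤ ξ / 2 * ‖x‖ := by
    intro x
    have h := len_leastSquares_sub_le hd hn0 hX (fun p => (hen p).1) hΛ0 (by positivity) hscore
      x.ofLp
    change len ((leastSquares X Y - A) *ᵥ x.ofLp) ≤ ξ / 2 * len x.ofLp
    refine h.trans (mul_le_mul_of_nonneg_right ?_ (len_nonneg _))
    rw [mul_assoc, ← Real.sqrt_mul (by positivity), hξ]
    have h1 : 6 * D * n * σ ^ 2 * (2 / n * (1 / (n * Λ))) = 12 * (σ ^ 2 * (D / (n * Λ))) := by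
      field_simp; ring
    rw [h1, Real.sqrt_mul (by norm_num), Real.sqrt_mul (by positivity), Real.sqrt_sq hσ0]
    -- The origin of `κ ≥ 50`: `7 √12 ≤ 25`, which has to be at most `κ / 2`.
    have h2 : √12 ≤ 25 / 7 := by
      rw [Real.sqrt_le_left (by norm_num)]; norm_num
    calc 7 * (√12 * (σ * √(D / (n * Λ)))) ≤ 7 * (25 / 7 * (σ * √(D / (n * Λ)))) := by gcongr
      _ = 50 * σ * √(D / (n * Λ)) / 2 := by ring
      _ ≤ κ * σ * √(D / (n * Λ)) / 2 := by gcongr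
  have hmain := frobSq_svThreshold_sub_le (leastSquares X Y) A hξ0 hop k
  refine hmain.trans ?_
  have htail : 0 ≤ ∑ i ∈ Finset.Ico k d, singularValue A i ^ 2 :=
    Finset.sum_nonneg fun _ _ => sq_nonneg _
  have hξ2 : ξ ^ 2 ≤ 2 * κ ^ 2 * (σ ^ 2 * D / (n * lamMin (gramian A))) := by
    rw [hξ, mul_pow, mul_pow, Real.sq_sqrt (by positivity)]
    have h3 : D / (n * Λ) ≤ 2 * (D / (n * lamMin (gramian A))) := by
      rw [← mul_div_assoc, div_le_div_iff₀ (by positivity) (by nlinarith)]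
      have : D * n * lamMin (gramian A) ≤ D * n * (2 * Λ) := by gcongr
      linarith
    calc κ ^ 2 * σ ^ 2 * (D / (n * Λ))
        ≤ κ ^ 2 * σ ^ 2 * (2 * (D / (n * lamMin (gramian A)))) := by gcongr
      _ = _ := by ring
  have hk : 10 * k * ξ ^ 2 ≤ 10 * k * (2 * κ ^ 2 * (σ ^ 2 * D / (n * lamMin (gramian A)))) := by
    gcongr
  have hκ2 : 1 ≤ κ ^ 2 := by nlinarith
  rw [tradeOff, ← hDdef]
  have h4 : 20 * κ ^ 2 * (k * σ ^ 2 * D / (n * lamMin (gramian A))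
      + ∑ i ∈ Finset.Ico k d, singularValue A i ^ 2)
      = 10 * k * (2 * κ ^ 2 * (σ ^ 2 * D / (n * lamMin (gramian A))))
        + 20 * κ ^ 2 * ∑ i ∈ Finset.Ico k d, singularValue A i ^ 2 := by ring
  rw [h4]
  nlinarith

end LTI

theorem mainTheorem7 :
    ∃ κ₀ c C : ℝ, 0 < κ₀ ∧ 0 < c ∧ 0 < C ∧
      ∀ (d n r : ℕ) (A : Matrix (Fin d) (Fin d) ℝ) (σ : ℝ≥0) (δ κ : ℝ)
        (Ω : Type*) [MeasurableSpace Ω] (P : Measure Ω) [IsProbabilityMeasure P]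
        (η : ℕ → Ω → Fin d → ℝ),
        0 < δ → δ < 1 → κ₀ ≤ κ →
        LTI.Stable A → A.rank ≤ r →
        -- the noise: i.i.d., centred, `σ²`-subgaussian, with covariance at least the identity
        (∀ t, Measurable (η t)) →
        iIndepFun η P →
        (∀ t, IdentDistrib (η t) (η 0) P P) →
        (∀ t, ∫ ω, η t ω ∂P = 0) →
        (∀ t, ∀ u : Fin d → ℝ, u ⬝ᵥ u = 1 →
          HasSubgaussianMGF (fun ω => u ⬝ᵥ η t ω) (σ ^ 2) P) →
        (∀ t, ∀ u : Fin d → ℝ, u ⬝ᵥ u = 1 → 1 ≤ ∫ ω, (u ⬝ᵥ η t ω) ^ 2 ∂P) →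
        -- the burn-in condition
        c * (σ : ℝ) ^ 4 * LTI.opNorm (LTI.gramian A) ^ 3 / LTI.lamMin (LTI.gramian A)
            * ((d : ℝ) + Real.log (1 / δ)) ≤ n →
        ∃ E : Set Ω, MeasurableSet E ∧ ENNReal.ofReal (1 - δ) ≤ P E ∧ ∀ ω ∈ E,
          let x := LTI.trajectory A (fun t => η t ω)
          IsUnit ((LTI.covariates n x)ᵀ * LTI.covariates n x) ∧
          LTI.frobSq (LTI.tlse κ σ δ n x - A) ≤
            C * κ ^ 2 * (Finset.range (r + 1)).inf' Finset.nonempty_range_add_one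
              (fun k => LTI.tradeOff A σ δ n k) := by
  refine ⟨50, 6 * 2 ^ 23, 20, by norm_num, by norm_num, by norm_num, ?_⟩
  intro d n r A σ δ κ Ω _ P _ η hδ hδ1 hκ hA _ hm hi hid _ hsub hvar hn
  -- For `d = 0` the spectrum is empty and `lamMin` takes the default value 0, so the trade-off is 0
  -- and the error is 0 as well.
  rcases Nat.eq_zero_or_pos d with rfl | hd
  · refine ⟨Set.univ, MeasurableSet.univ, ?_, fun ω _ => ⟨?_, ?_⟩⟩
    · rw [measure_univ]
      exact ENNReal.ofReal_le_one.2 (by linarith)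
    · exact isUnit_of_subsingleton _
    · refine le_trans (le_of_eq ?_) (mul_nonneg (by positivity)
        ((Finset.le_inf'_iff _ _).2 fun k _ => ?_))
      · simp [LTI.frobSq]
      · simp [LTI.tradeOff, LTI.lamMin]
  have hL : 0 ≤ Real.log (1 / δ) := Real.log_nonneg (by rw [le_div_iff₀ hδ]; linarith)
  have hd' : (0 : ℝ) < d := by exact_mod_cast hd
  have hD : 0 < (d : ℝ) + Real.log (1 / δ) := by linarith
  have hσ := LTI.half_le_sq_of_subgaussian hd hm hsub hvar
  have hQ := LTI.noiseCov_bounds hd hm hid hsub hvar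
  have hG := LTI.one_le_opNorm_gramian hA hd
  obtain ⟨hlam1, hlamG⟩ := LTI.one_le_lamMin_gramian hA hd
  have hn2 : 2 ^ 23 * (((σ : ℝ) ^ 2) ^ 2 * LTI.opNorm (LTI.gramian A)
      * (6 * (d + Real.log (1 / δ)))) ≤ n := by
    refine le_trans ?_ hn
    -- Only the first power of `‖Γ‖` is needed; it is dominated by `‖Γ‖³ / λ_min(Γ)` since `‖Γ‖ ≥ 1`
    -- and `λ_min(Γ) ≤ ‖Γ‖`.
    have h1 : LTI.opNorm (LTI.gramian A)
        ≤ LTI.opNorm (LTI.gramian A) ^ 3 / LTI.lamMin (LTI.gramian A) := by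
      rw [le_div_iff₀ (by linarith)]
      nlinarith [mul_le_mul_of_nonneg_left hlamG (by linarith : 0 ≤ LTI.opNorm (LTI.gramian A)),
        mul_le_mul_of_nonneg_left hG (sq_nonneg (LTI.opNorm (LTI.gramian A)))]
    calc _ = 6 * 2 ^ 23 * (σ : ℝ) ^ 4 * LTI.opNorm (LTI.gramian A)
          * ((d : ℝ) + Real.log (1 / δ)) := by ring
      _ ≤ 6 * 2 ^ 23 * (σ : ℝ) ^ 4 * (LTI.opNorm (LTI.gramian A) ^ 3
          / LTI.lamMin (LTI.gramian A)) * ((d : ℝ) + Real.log (1 / δ)) := by gcongr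
      _ = _ := by ring
  have hn0 : 0 < n := by
    have : (0 : ℝ) < n := lt_of_lt_of_le (by positivity) hn2
    exact_mod_cast this
  obtain ⟨T, hT, hcard⟩ := LTI.exists_isHalfNet d
  have hQherm : (LTI.noiseCov P η).IsHermitian := by
    rw [Matrix.IsHermitian, Matrix.conjTranspose_eq_transpose_of_trivial, LTI.transpose_noiseCov]
  -- The whitening depends only on `A` and the noise covariance. Being deterministic, it may enter
  -- the test functions before the good event is chosen.
  obtain ⟨B, R, hBR, hB, hR⟩ := LTI.exists_whitening (LTI.isHermitian_gramianOf (A := A) hQherm)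
    fun u => (LTI.dotProduct_le_gramian hA u).trans (by
      rw [LTI.gramian_eq]
      exact hA.gramianOf_mono (fun u => by rw [Matrix.one_mulVec]; exact (hQ u).1) u)
  obtain ⟨E, hE, hPE, hgood⟩ :=
    LTI.exists_goodEvent hd A B hδ hδ1 hm hi hid hsub hσ hT hcard n rfl
  refine ⟨E, hE, hPE, fun ω hω => ?_⟩
  obtain ⟨hX, hbound⟩ := LTI.tlse_bound_of_testFunctions hA hd hn0 hT σ.2 hσ LTI.transpose_noiseCov
    (fun u => (hQ u).1) (fun u => (hQ u).2) hD hκ hn2 hBR hB hR (hgood ω hω)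
  refine ⟨hX, ?_⟩
  obtain ⟨k, -, hk⟩ := Finset.exists_mem_eq_inf' Finset.nonempty_range_add_one
    (s := Finset.range (r + 1)) fun k => LTI.tradeOff A σ δ n k
  rw [hk]
  exact hbound k
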